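/- Let $\mathcal H_1$ be a separable complex Hilbert space, with scalar product $\langle\cdot,\cdot\rangle$ antilinear in the first argument, and let $\mathcal H$ be the antisymmetric (fermionic) Fock space over $\mathcal H_1$, with vacuum vector $\Omega$ and the bounded creation and annihilation operators $a^*(\psi)$, $a(\psi)=a^*(\psi)^*$ for $\psi\in\mathcal H_1$, where $a^*(\psi)$ depends linearly on $\psi$ and $$a(\psi_1)a(\psi_2)+a(\psi_2)a(\psi_1)=0,\qquad a(\psi_1)a^*(\psi_2)+a^*(\psi_2)a(\psi_1)=\langle\psi_1,\psi_2\rangle\cdot 1 .$$ Let $\Gamma$ be an antiunitary involution on $\mathcal H_1$, let $\mathcal L_\varphi,\mathcal L_\pi\subset\mathcal H_1$ be closed complex subspaces which are invariant under $\Gamma$, let $E_\varphi,E_\pi$ be the orthogonal projections onto them, and put $$\mathcal K:=(1+\Gamma)\mathcal L_\varphi+(1-\Gamma)\mathcal L_\pi ,\qquad \phi[\psi]:=a^*(\psi)+a(\psi),\qquad \mathcal A_{\mathcal K}:=\{\phi[\psi]:\psi\in\mathcal K\}''\subset\mathcal B(\mathcal H).$$ Assume that $\Omega$ is separating for the von Neumann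 algebra $\mathcal A_{\mathcal K}$. Let $X$ be a densely defined, strictly positive, not necessarily bounded operator on $\mathcal H_1$ (that is, $\langle\psi,X\psi\rangle>0$ for all $\psi\neq0$ in its domain) which commutes with $\Gamma$ (that is, $\Gamma$ maps the domain of $X$ into itself and $X\Gamma=\Gamma X$ there). Denote its second quantization, the closed operator $\bigoplus_{n\ge0}X^{\otimes n}$ on $\mathcal H$, by $X$ as well (it is the closure of the operator defined on finite linear combinations of antisymmetrized products of vectors $\psi_i$ of the domain of $X$ by $\psi_1\wedge\dots\wedge\psi_n\mapsto X\psi_1\wedge\dots\wedge X\psi_n$), and assume that $\mathcal A_{\mathcal K}\Omega$ is contained in its domain. Assume that $E_\varphi X$ and $E_\pi X$ extend to trace class operators on $\mathcal H_1$, and write $\|E_\varphi X\|_1$, $\|E_\pi X\|_1$ for the trace norms $\|T\|_1=\mathrm{Tr}\,(T^*T)^{1/2}$ of these extensions. Then the linear map $$\Xi:\mathcal A_{\mathcal K}\longrightarrow\mathcal H,\qquad \Xi(A):=XA\Omega ,$$ is nuclear with respect to the operator norm on $\mathcal A_{\mathcal K}$ and the norm of $\mathcal H$, and its nuclear norm is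 bounded by $$\|\Xi\|_1\le e^{2\|E_\varphi X\|_1}\cdot e^{2\|E_\pi X\|_1}.$$ Here a linear map $T:\mathcal X\to\mathcal Y$ between Banach spaces is called nuclear if there are bounded linear functionals $\rho_n$ on $\mathcal X$ and vectors $\Psi_n\in\mathcal Y$ with $\sum_{n=1}^\infty\|\rho_n\|\,\|\Psi_n\|<\infty$ and $T(\xi)=\sum_{n=1}^\infty\rho_n(\xi)\Psi_n$ for all $\xi\in\mathcal X$, and its nuclear norm $\|T\|_1$ is the infimum of $\sum_{n=1}^\infty\|\rho_n\|\,\|\Psi_n\|$ over all such sequences. -/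

import Mathlib

noncomputable section
namespace FermiFock

variable {H : Type*} [NormedAddCommGroup H] [InnerProductSpace ℂ H]

/-- The annihilation operator `a(ψ)` on finite linear combinations of wedge products: the interior
product `v₁ ∧ … ∧ vₙ ↦ ∑ₖ (-1)ᵏ⁻¹ ⟨ψ, vₖ⟩ v₁ ∧ … v̂ₖ … ∧ vₙ`. It is antilinear in `ψ`. -/
def algAnnihilate (ψ : H) : ExteriorAlgebra ℂ H →ₗ[ℂ] ExteriorAlgebra ℂ H :=
  CliffordAlgebra.contractLeft (Q := (0 : QuadraticForm ℂ H)) (innerₛₗ ℂ ψ)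

theorem algAnnihilate_ι_mul (ψ χ : H) (x : ExteriorAlgebra ℂ H) :
    algAnnihilate ψ (ExteriorAlgebra.ι ℂ χ * x) =
      inner ℂ ψ χ • x - ExteriorAlgebra.ι ℂ χ * algAnnihilate ψ x :=
  CliffordAlgebra.contractLeft_ι_mul _ _ _

theorem algAnnihilate_algebraMap (ψ : H) (r : ℂ) :
    algAnnihilate ψ (algebraMap ℂ (ExteriorAlgebra ℂ H) r) = 0 :=
  CliffordAlgebra.contractLeft_algebraMap (Q := (0 : QuadraticForm ℂ H)) _ _

theorem algAnnihilate_add (ψ χ : H) :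
    algAnnihilate (ψ + χ) = algAnnihilate ψ + algAnnihilate χ := by
  simp [algAnnihilate]

theorem algAnnihilate_smul (c : ℂ) (ψ : H) :
    algAnnihilate (c • ψ) = (starRingEnd ℂ c) • algAnnihilate ψ := by
  simp [algAnnihilate]

theorem left_induction {P : ExteriorAlgebra ℂ H → Prop}
    (algebraMap : ∀ r : ℂ, P (algebraMap ℂ _ r)) (add : ∀ x y, P x → P y → P (x + y))
    (ι_mul : ∀ x v, P x → P (ExteriorAlgebra.ι ℂ v * x)) (x) : P x :=
  CliffordAlgebra.left_induction (0 : QuadraticForm ℂ H) algebraMap add ι_mul x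

/-- The complex conjugate of the component of degree zero. -/
def conjVacuum : ExteriorAlgebra ℂ H →ₗ⋆[ℂ] ℂ where
  toFun x := starRingEnd ℂ (ExteriorAlgebra.algebraMapInv x)
  map_add' := by simp
  map_smul' := by simp

/-- `formAux ψ` sends an antilinear functional `f` to `f ∘ a(ψ)`. -/
def formAux : H →ₗ[ℂ] Module.End ℂ (ExteriorAlgebra ℂ H →ₗ⋆[ℂ] ℂ) where
  toFun ψ :=
    { toFun := fun f => f.comp (algAnnihilate ψ)
      map_add' := fun _ _ => rfl
      map_smul' := fun _ _ => rfl }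
  map_add' ψ χ := by
    ext f x
    simp [algAnnihilate_add]
  map_smul' c ψ := by
    ext f x
    simp [algAnnihilate_smul]

/-- The scalar product of the antisymmetric Fock space on the exterior algebra, antilinear in the
first argument. It is determined by `⟨x, 1⟩ = conj (x₀)`, with `x₀` the component of degree zero, and
`⟨x, v ∧ y⟩ = ⟨a(v) x, y⟩`; hence wedge products of different degrees are orthogonal and
`⟨v₁ ∧ … ∧ vₙ, w₁ ∧ … ∧ wₙ⟩ = det (⟨vᵢ, wⱼ⟩)`. -/
def form (x y : ExteriorAlgebra ℂ H) : ℂ :=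
  ExteriorAlgebra.lift ℂ ⟨formAux (H := H), fun ψ => by
    ext f x
    change f (algAnnihilate ψ (algAnnihilate ψ x)) = 0
    rw [algAnnihilate, CliffordAlgebra.contractLeft_contractLeft, map_zero]⟩ y conjVacuum x

theorem form_add_left (x x' y : ExteriorAlgebra ℂ H) :
    form (x + x') y = form x y + form x' y := by simp [form]

theorem form_smul_left (c : ℂ) (x y : ExteriorAlgebra ℂ H) :
    form (c • x) y = starRingEnd ℂ c * form x y := by simp [form]

theorem form_add_right (x y y' : ExteriorAlgebra ℂ H) :
    form x (y + y') = form x y + form x y' := by simp [form]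

theorem form_smul_right (c : ℂ) (x y : ExteriorAlgebra ℂ H) :
    form x (c • y) = c * form x y := by simp [form]

theorem form_sub_left (x x' y : ExteriorAlgebra ℂ H) :
    form (x - x') y = form x y - form x' y := by simp [form]

theorem form_sub_right (x y y' : ExteriorAlgebra ℂ H) :
    form x (y - y') = form x y - form x y' := by simp [form]

theorem form_zero_left (y : ExteriorAlgebra ℂ H) : form 0 y = 0 := by simp [form]

theorem form_zero_right (x : ExteriorAlgebra ℂ H) : form x 0 = 0 := by simp [form]

theorem form_algebraMap_right (x : ExteriorAlgebra ℂ H) (r : ℂ) :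
    form x (algebraMap ℂ _ r) = r * starRingEnd ℂ (ExteriorAlgebra.algebraMapInv x) := by
  simp [form, conjVacuum]

theorem form_ι_mul_right (ψ : H) (x y : ExteriorAlgebra ℂ H) :
    form x (ExteriorAlgebra.ι ℂ ψ * y) = form (algAnnihilate ψ x) y := by
  simp only [form, map_mul, ExteriorAlgebra.lift_ι_apply]
  rfl

theorem form_ι_mul_left (ψ : H) (x y : ExteriorAlgebra ℂ H) :
    form (ExteriorAlgebra.ι ℂ ψ * x) y = form x (algAnnihilate ψ y) := by
  induction y using left_induction generalizing x with
  | algebraMap r =>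
    rw [algAnnihilate_algebraMap, form_algebraMap_right, form_zero_right]
    simp [ExteriorAlgebra.algebraMapInv]
  | add y y' hy hy' => rw [map_add, form_add_right, form_add_right, hy, hy']
  | ι_mul y χ hy =>
    rw [form_ι_mul_right, algAnnihilate_ι_mul, algAnnihilate_ι_mul, form_sub_left,
      form_sub_right, form_smul_left, form_smul_right, form_ι_mul_right, hy, inner_conj_symm]

theorem form_conj_symm (x y : ExteriorAlgebra ℂ H) :
    starRingEnd ℂ (form y x) = form x y := by
  have h1 : ∀ x : ExteriorAlgebra ℂ H, form 1 x = ExteriorAlgebra.algebraMapInv x := by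
    intro x
    induction x using left_induction with
    | algebraMap r => simp [form_algebraMap_right]
    | add x x' hx hx' => rw [form_add_right, hx, hx', map_add]
    | ι_mul x χ hx =>
      rw [form_ι_mul_right, ← map_one (algebraMap ℂ (ExteriorAlgebra ℂ H)),
        algAnnihilate_algebraMap, form_zero_left]
      simp [ExteriorAlgebra.algebraMapInv]
  induction y using left_induction generalizing x with
  | algebraMap r =>
    rw [form_algebraMap_right, Algebra.algebraMap_eq_smul_one, form_smul_left, h1]
    simp
  | add y y' hy hy' => rw [form_add_left, form_add_right, map_add, hy, hy']
  | ι_mul y χ hy => rw [form_ι_mul_left, form_ι_mul_right, hy]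

/-- The span of the ordered wedge products of the members of a list. -/
def words : List H → Submodule ℂ (ExteriorAlgebra ℂ H)
  | [] => Submodule.span ℂ {1}
  | e :: l => words l ⊔ (words l).map (LinearMap.mulLeft ℂ (ExteriorAlgebra.ι ℂ e))

theorem mem_words_cons {e : H} {l : List H} {x : ExteriorAlgebra ℂ H} :
    x ∈ words (e :: l) ↔
      ∃ y ∈ words l, ∃ z ∈ words l, x = y + ExteriorAlgebra.ι ℂ e * z := by
  simp only [words, Submodule.mem_sup, Submodule.mem_map, LinearMap.mulLeft_apply]
  constructor
  · rintro ⟨y, hy, _, ⟨z, hz, rfl⟩, rfl⟩; exact ⟨y, hy, z, hz, rfl⟩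
  · rintro ⟨y, hy, z, hz, rfl⟩; exact ⟨y, hy, _, ⟨z, hz, rfl⟩, rfl⟩

theorem one_mem_words (l : List H) : (1 : ExteriorAlgebra ℂ H) ∈ words l := by
  induction l with
  | nil => exact Submodule.mem_span_singleton_self _
  | cons e l ih => exact Submodule.mem_sup_left ih

theorem ι_mul_mem_words {l : List H} {v : H} (hv : v ∈ l) {x : ExteriorAlgebra ℂ H}
    (hx : x ∈ words l) : ExteriorAlgebra.ι ℂ v * x ∈ words l := by
  induction l generalizing x with
  | nil => simp at hv
  | cons e l ih =>
    obtain ⟨y, hy, z, hz, rfl⟩ := mem_words_cons.1 hx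
    rw [mem_words_cons]
    rcases List.mem_cons.1 hv with rfl | hv
    · refine ⟨0, zero_mem _, y, hy, ?_⟩
      rw [mul_add, ← mul_assoc, ExteriorAlgebra.ι_sq_zero]
      simp
    · refine ⟨_, ih hv hy, _, neg_mem (ih hv hz), ?_⟩
      have := eq_neg_of_add_eq_zero_left (ExteriorAlgebra.ι_add_mul_swap (R := ℂ) v e)
      rw [mul_add, ← mul_assoc, this]
      simp [mul_assoc]

theorem ι_mul_mem_words_of_span {l : List H} {v : H} (hv : v ∈ Submodule.span ℂ {a | a ∈ l})
    {x : ExteriorAlgebra ℂ H} (hx : x ∈ words l) : ExteriorAlgebra.ι ℂ v * x ∈ words l := by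
  induction hv using Submodule.span_induction with
  | mem v hv => exact ι_mul_mem_words hv hx
  | zero => simp
  | add v w _ _ hv hw => rw [map_add, add_mul]; exact add_mem hv hw
  | smul c v _ hv => rw [map_smul, smul_mul_assoc]; exact Submodule.smul_mem _ _ hv

theorem algAnnihilate_words {l : List H} {e : H} (he : ∀ v ∈ l, inner ℂ e v = 0)
    {x : ExteriorAlgebra ℂ H} (hx : x ∈ words l) : algAnnihilate e x = 0 := by
  induction l generalizing x with
  | nil =>
    obtain ⟨c, rfl⟩ := Submodule.mem_span_singleton.1 hx
    rw [← Algebra.algebraMap_eq_smul_one, algAnnihilate_algebraMap]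
  | cons v l ih =>
    obtain ⟨y, hy, z, hz, rfl⟩ := mem_words_cons.1 hx
    have he' : ∀ v ∈ l, inner ℂ e v = 0 := fun w hw => he w (List.mem_cons_of_mem _ hw)
    rw [map_add, algAnnihilate_ι_mul, ih he' hy, ih he' hz, he v List.mem_cons_self]
    simp

theorem form_self_words {l : List H} (h1 : ∀ v ∈ l, ‖v‖ = 1)
    (h2 : l.Pairwise fun v w => inner ℂ v w = 0) {x : ExteriorAlgebra ℂ H} (hx : x ∈ words l) :
    0 ≤ (form x x).re ∧ ((form x x).re = 0 → x = 0) := by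
  induction l generalizing x with
  | nil =>
    obtain ⟨c, rfl⟩ := Submodule.mem_span_singleton.1 hx
    rw [← Algebra.algebraMap_eq_smul_one, form_algebraMap_right]
    have : (c * starRingEnd ℂ ((ExteriorAlgebra.algebraMapInv (M := H))
        (algebraMap ℂ (ExteriorAlgebra ℂ H) c))).re = Complex.normSq c := by
      simp [Complex.mul_conj]
    rw [this]
    refine ⟨Complex.normSq_nonneg _, fun h => ?_⟩
    rw [Complex.normSq_eq_zero.1 h, map_zero]
  | cons e l ih =>
    obtain ⟨y, hy, z, hz, rfl⟩ := mem_words_cons.1 hx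
    rw [List.pairwise_cons] at h2
    have ih' := @ih (fun w hw => h1 w (List.mem_cons_of_mem _ hw)) h2.2
    have hay := algAnnihilate_words h2.1 hy
    have haz := algAnnihilate_words h2.1 hz
    have key : form (y + ExteriorAlgebra.ι ℂ e * z) (y + ExteriorAlgebra.ι ℂ e * z) =
        form y y + form z z := by
      rw [form_add_left, form_add_right, form_add_right, form_ι_mul_right, hay, form_zero_left,
        form_ι_mul_left, hay, form_zero_right, form_ι_mul_left, algAnnihilate_ι_mul, haz,
        inner_self_eq_norm_sq_to_K, h1 e List.mem_cons_self]
      simp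
    rw [key, Complex.add_re]
    obtain ⟨p, p'⟩ := ih' hy
    obtain ⟨q, q'⟩ := ih' hz
    refine ⟨add_nonneg p q, fun h => ?_⟩
    rw [p' (by linarith), q' (by linarith)]
    simp

theorem exists_words (x : ExteriorAlgebra ℂ H) :
    ∃ l : List H, (∀ v ∈ l, ‖v‖ = 1) ∧ (l.Pairwise fun v w => inner ℂ v w = 0) ∧
      x ∈ words l := by
  classical
  have h : ∃ s : Finset H, ∀ l : List H, (s : Set H) ⊆ Submodule.span ℂ {a | a ∈ l} →
      x ∈ words l := by
    induction x using left_induction with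
    | algebraMap r =>
      refine ⟨∅, fun l _ => ?_⟩
      rw [Algebra.algebraMap_eq_smul_one]
      exact Submodule.smul_mem _ _ (one_mem_words l)
    | add x y hx hy =>
      obtain ⟨s, hs⟩ := hx
      obtain ⟨t, ht⟩ := hy
      refine ⟨s ∪ t, fun l hl => add_mem (hs l fun a ha => hl ?_) (ht l fun a ha => hl ?_)⟩
      · simp [Finset.mem_coe.1 ha]
      · simp [Finset.mem_coe.1 ha]
    | ι_mul x v hx =>
      obtain ⟨s, hs⟩ := hx
      refine ⟨insert v s, fun l hl => ι_mul_mem_words_of_span (hl (by simp))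
        (hs l fun a ha => hl ?_)⟩
      simp [Finset.mem_coe.1 ha]
  obtain ⟨s, hs⟩ := h
  let V : Submodule ℂ H := Submodule.span ℂ (s : Set H)
  let b := stdOrthonormalBasis ℂ V
  have hb : ∀ i j, inner ℂ (b i : H) (b j : H) = if i = j then 1 else 0 := fun i j => by
    rw [← Submodule.coe_inner]; exact orthonormal_iff_ite.1 b.orthonormal i j
  refine ⟨List.ofFn fun i => (b i : H), ?_, ?_, hs _ ?_⟩
  · intro v hv
    obtain ⟨i, rfl⟩ := (List.mem_ofFn' _ _).1 hv
    exact b.norm_eq_one i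
  · rw [List.pairwise_ofFn]
    intro i j hij
    rw [hb, if_neg hij.ne]
  · intro a ha
    have haV : a ∈ V := Submodule.subset_span ha
    have := b.sum_repr ⟨a, haV⟩
    have h2 : a = ∑ i, b.repr ⟨a, haV⟩ i • (b i : H) := by
      conv_lhs => rw [show a = ((⟨a, haV⟩ : V) : H) from rfl, ← this]
      simp
    rw [h2]
    refine Submodule.sum_mem _ fun i _ => Submodule.smul_mem _ _ (Submodule.subset_span ?_)
    exact (List.mem_ofFn' _ _).2 ⟨i, rfl⟩

/-- The exterior algebra of `H` with its determinant scalar product. -/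
@[reducible] def innerCore : InnerProductSpace.Core ℂ (ExteriorAlgebra ℂ H) where
  inner := form
  conj_inner_symm := form_conj_symm
  add_left := form_add_left
  smul_left x y c := form_smul_left c x y
  re_inner_nonneg x := by
    obtain ⟨l, h1, h2, hx⟩ := exists_words x
    exact (form_self_words h1 h2 hx).1
  definite x hx := by
    obtain ⟨l, h1, h2, hxl⟩ := exists_words x
    exact (form_self_words h1 h2 hxl).2 (by rw [hx]; rfl)

instance : NormedAddCommGroup (ExteriorAlgebra ℂ H) :=
  (innerCore (H := H)).toNormedAddCommGroup

instance : InnerProductSpace ℂ (ExteriorAlgebra ℂ H) :=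
  InnerProductSpace.ofCore (innerCore (H := H)).toCore

variable (H) in
/-- The antisymmetric (fermionic) Fock space over `H`, as the Hilbert space completion of the exterior
algebra of `H`. -/
def Fock : Type _ := UniformSpace.Completion (ExteriorAlgebra ℂ H)

instance : NormedAddCommGroup (Fock H) :=
  inferInstanceAs (NormedAddCommGroup (UniformSpace.Completion (ExteriorAlgebra ℂ H)))

instance : InnerProductSpace ℂ (Fock H) :=
  inferInstanceAs (InnerProductSpace ℂ (UniformSpace.Completion (ExteriorAlgebra ℂ H)))

instance : CompleteSpace (Fock H) :=
  inferInstanceAs (CompleteSpace (UniformSpace.Completion (ExteriorAlgebra ℂ H)))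

/-- The isometric embedding of the exterior algebra into its completion. -/
def toFock : ExteriorAlgebra ℂ H →ₗᵢ[ℂ] Fock H :=
  UniformSpace.Completion.toComplₗᵢ (𝕜 := ℂ) (E := ExteriorAlgebra ℂ H)

theorem norm_ι_mul_le (ψ : H) (x : ExteriorAlgebra ℂ H) :
    ‖ExteriorAlgebra.ι ℂ ψ * x‖ ≤ ‖ψ‖ * ‖x‖ := by
  have e1 : inner ℂ (ExteriorAlgebra.ι ℂ ψ * x) (ExteriorAlgebra.ι ℂ ψ * x) =
      inner ℂ ψ ψ * inner ℂ x x - inner ℂ (algAnnihilate ψ x) (algAnnihilate ψ x) := by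
    change form _ _ = _ * form x x - form _ _
    rw [form_ι_mul_left, algAnnihilate_ι_mul, form_sub_right, form_smul_right, form_ι_mul_right]
  have e2 : ‖ExteriorAlgebra.ι ℂ ψ * x‖ ^ 2 =
      ‖ψ‖ ^ 2 * ‖x‖ ^ 2 - ‖algAnnihilate ψ x‖ ^ 2 := by
    apply Complex.ofReal_injective
    push_cast
    simpa [inner_self_eq_norm_sq_to_K] using e1
  have e3 : ‖ExteriorAlgebra.ι ℂ ψ * x‖ ^ 2 ≤ (‖ψ‖ * ‖x‖) ^ 2 := by
    rw [mul_pow]; nlinarith [sq_nonneg ‖algAnnihilate ψ x‖]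
  exact le_of_sq_le_sq e3 (by positivity)

/-- The creation operator `a*(ψ)`, the bounded extension of `x ↦ ψ ∧ x`. -/
def creation (ψ : H) : Fock H →L[ℂ] Fock H :=
  ContinuousLinearMap.completion ((LinearMap.mulLeft ℂ (ExteriorAlgebra.ι ℂ ψ)).mkContinuous ‖ψ‖
    (norm_ι_mul_le ψ))

/-- The annihilation operator `a(ψ)`, the adjoint of `a*(ψ)`. -/
def annihilation (ψ : H) : Fock H →L[ℂ] Fock H := ContinuousLinearMap.adjoint (creation ψ)

variable (H) in
/-- The Fock vacuum `Ω`. -/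
def vacuum : Fock H := toFock 1

/-- The field operator `φ[ψ] = a*(ψ) + a(ψ)`. -/
def fermiField (ψ : H) : Fock H →L[ℂ] Fock H := creation ψ + annihilation ψ

theorem star_fermiField (ψ : H) : star (fermiField ψ) = fermiField ψ := by
  rw [fermiField, annihilation, star_add, ← ContinuousLinearMap.star_eq_adjoint, star_star, add_comm]

/-- The von Neumann algebra `{φ[ψ] : ψ ∈ K}''`. -/
def fieldAlgebra (K : Set H) : VonNeumannAlgebra (Fock H) where
  toSubalgebra := Subalgebra.centralizer ℂ (Set.centralizer (fermiField '' K))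
  star_mem' := by
    intro a ha b hb
    have hb' : star b ∈ Set.centralizer (fermiField '' K) := by
      rintro _ ⟨ψ, hψ, rfl⟩
      have := congrArg star (hb _ ⟨ψ, hψ, rfl⟩)
      rw [star_mul, star_mul, star_fermiField] at this
      exact this.symm
    have := congrArg star (ha _ hb')
    rw [star_mul, star_mul, star_star] at this
    exact this.symm
  centralizer_centralizer' := Set.centralizer_centralizer_centralizer _

theorem coe_fieldAlgebra (K : Set H) : (fieldAlgebra K : Set (Fock H →L[ℂ] Fock H)) =
    Set.centralizer (Set.centralizer (fermiField '' K)) := rfl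

/-- The real subspace `(1 + Γ) Lφ + (1 - Γ) Lπ`. -/
def realSubspace (Γ : H ≃ₗᵢ⋆[ℂ] H) (Lφ Lπ : Submodule ℂ H) : Submodule ℝ H where
  carrier := {ψ | ∃ u ∈ Lφ, ∃ v ∈ Lπ, ψ = (u + Γ u) + (v - Γ v)}
  zero_mem' := ⟨0, zero_mem _, 0, zero_mem _, by simp⟩
  add_mem' := by
    rintro _ _ ⟨u, hu, v, hv, rfl⟩ ⟨u', hu', v', hv', rfl⟩
    refine ⟨u + u', add_mem hu hu', v + v', add_mem hv hv', ?_⟩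
    rw [map_add, map_add]
    abel
  smul_mem' := by
    rintro c _ ⟨u, hu, v, hv, rfl⟩
    refine ⟨(c : ℂ) • u, Lφ.smul_mem _ hu, (c : ℂ) • v, Lπ.smul_mem _ hv, ?_⟩
    rw [map_smulₛₗ, map_smulₛₗ, Complex.conj_ofReal]
    simp [smul_add, smul_sub]

/-- The embedding of the exterior algebra of a subspace into the Fock space. -/
def subspaceEmbedding (D : Submodule ℂ H) : ExteriorAlgebra ℂ D →ₗ[ℂ] Fock H :=
  (toFock (H := H)).toLinearMap ∘ₗ
    (ExteriorAlgebra.map D.subtype).toLinearMap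

theorem subspaceEmbedding_injective (D : Submodule ℂ H) :
    Function.Injective (subspaceEmbedding D) :=
  (toFock (H := H)).injective.comp
    (ExteriorAlgebra.map_injective_field (Submodule.ker_subtype D))

/-- The second quantization of `X` on finite linear combinations of wedge products of vectors of the
domain of `X`: `v₁ ∧ … ∧ vₙ ↦ X v₁ ∧ … ∧ X vₙ`. -/
def algSecondQuantization (X : H →ₗ.[ℂ] H) : Fock H →ₗ.[ℂ] Fock H where
  domain := LinearMap.range (subspaceEmbedding X.domain)
  toFun :=
    (toFock (H := H)).toLinearMap ∘ₗ
      (ExteriorAlgebra.map X.toFun).toLinearMap ∘ₗ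
      (LinearEquiv.ofInjective _ (subspaceEmbedding_injective X.domain)).symm.toLinearMap

/-- The second quantization `⨁ₙ X^{⊗n}` of `X`, a closed operator on the Fock space. -/
def secondQuantization (X : H →ₗ.[ℂ] H) : Fock H →ₗ.[ℂ] Fock H :=
  (algSecondQuantization X).closure

/-- `X` is strictly positive: `⟨ψ, X ψ⟩` is real and positive for all `ψ ≠ 0` in the domain. -/
def StrictlyPositive (X : H →ₗ.[ℂ] H) : Prop :=
  ∀ ψ : X.domain, (ψ : H) ≠ 0 →
    (inner ℂ (ψ : H) (X ψ)).im = 0 ∧ 0 < (inner ℂ (ψ : H) (X ψ)).re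

/-- `X` commutes with the involution `Γ`: the domain is invariant and `X Γ = Γ X` on it. -/
def CommutesWith (X : H →ₗ.[ℂ] H) (Γ : H ≃ₗᵢ⋆[ℂ] H) : Prop :=
  ∀ ψ : X.domain, ∃ h : Γ ψ ∈ X.domain, X ⟨Γ ψ, h⟩ = Γ (X ψ)

/-- `A ↦ X A Ω` as a linear map on the von Neumann algebra `M`, for a (possibly unbounded) operator
`X` on the Fock space whose domain contains `M Ω`. -/
def vacuumMap (M : VonNeumannAlgebra (Fock H)) (X : Fock H →ₗ.[ℂ] Fock H)
    (hX : ∀ A ∈ M, A (vacuum H) ∈ X.domain) : M.toStarSubalgebra →ₗ[ℂ] Fock H :=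
  X.toFun ∘ₗ
    { toFun := fun A => ⟨(A : Fock H →L[ℂ] Fock H) (vacuum H), hX A A.2⟩
      map_add' := fun _ _ => rfl
      map_smul' := fun _ _ => rfl }

section TraceClass

theorem ofReal_norm_sq_eq_tsum {κ : Type*} (c : HilbertBasis κ ℂ H) (x : H) :
    ENNReal.ofReal (‖x‖ ^ 2) = ∑' j, ENNReal.ofReal (‖inner ℂ x (c j)‖ ^ 2) := by
  have h := (c.hasSum_inner_mul_inner x x).mapL Complex.reCLM
  have h' : HasSum (fun j => ‖inner ℂ x (c j)‖ ^ 2) (‖x‖ ^ 2) := by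
    convert h using 1
    · funext j
      rw [← inner_conj_symm (c j) x, Complex.mul_conj, Complex.reCLM_apply,
        Complex.ofReal_re, Complex.normSq_eq_norm_sq]
    · rw [Complex.reCLM_apply]
      exact (inner_self_eq_norm_sq (𝕜 := ℂ) _).symm
  rw [← h'.tsum_eq, ENNReal.ofReal_tsum_of_nonneg (fun _ => by positivity) h'.summable]

theorem tsum_norm_sq_eq {ι κ : Type*} (b : HilbertBasis ι ℂ H) (c : HilbertBasis κ ℂ H)
    {S : H →L[ℂ] H} (hS : ∀ x y, inner ℂ (S x) y = inner ℂ x (S y)) :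
    ∑' i, ENNReal.ofReal (‖S (b i)‖ ^ 2) = ∑' j, ENNReal.ofReal (‖S (c j)‖ ^ 2) := by
  simp_rw [fun i => ofReal_norm_sq_eq_tsum c (S (b i)),
    fun j => ofReal_norm_sq_eq_tsum b (S (c j))]
  rw [ENNReal.tsum_comm]
  refine tsum_congr fun j => tsum_congr fun i => ?_
  rw [hS, norm_inner_symm]

variable [CompleteSpace H]

/-- The trace norm `‖T‖₁ = Tr |T|`, with `|T| = (T* T)^{1/2}`, as an extended nonnegative number; the
trace is taken in some Hilbert basis of `H`. -/
def traceNorm (T : H →L[ℂ] H) : ENNReal :=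
  ∑' i, ENNReal.ofReal
    (inner ℂ ((exists_hilbertBasis ℂ H).choose_spec.choose i)
      (CFC.abs T ((exists_hilbertBasis ℂ H).choose_spec.choose i))).re

/-- `T` is trace class: `Tr |T| < ∞`. -/
def IsTraceClass (T : H →L[ℂ] H) : Prop := traceNorm T < ⊤

/-- The trace norm does not depend on the choice of the Hilbert basis. -/
theorem traceNorm_eq_tsum {ι : Type*} (b : HilbertBasis ι ℂ H) (T : H →L[ℂ] H) :
    traceNorm T = ∑' i, ENNReal.ofReal (inner ℂ (b i) (CFC.abs T (b i))).re := by
  have hsa : ∀ x y, inner ℂ (CFC.sqrt (CFC.abs T) x) y =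
      inner ℂ x (CFC.sqrt (CFC.abs T) y) := fun x y =>
    ((CFC.sqrt_nonneg (CFC.abs T)).isSelfAdjoint.isSymmetric x y)
  have h : ∀ x, (inner ℂ x (CFC.abs T x)).re = ‖CFC.sqrt (CFC.abs T) x‖ ^ 2 := by
    intro x
    conv_lhs => rw [← CFC.sqrt_mul_sqrt_self (CFC.abs T) (CFC.abs_nonneg T)]
    change (inner ℂ x (CFC.sqrt (CFC.abs T) (CFC.sqrt (CFC.abs T) x))).re = _
    rw [← hsa]
    exact inner_self_eq_norm_sq (𝕜 := ℂ) _
  simp_rw [traceNorm, h]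
  exact tsum_norm_sq_eq _ b hsa

end TraceClass

end FermiFock

section Nuclear

variable {E F : Type*} [NormedAddCommGroup E] [NormedSpace ℂ E]
  [NormedAddCommGroup F] [NormedSpace ℂ F]

/-- `T ξ = ∑ₙ ρₙ(ξ) Ψₙ` for all `ξ`, with `∑ₙ ‖ρₙ‖ ‖Ψₙ‖ < ∞`. -/
def IsNuclearDecomposition (T : E →ₗ[ℂ] F) (ρ : ℕ → StrongDual ℂ E) (Ψ : ℕ → F) : Prop :=
  Summable (fun n => ‖ρ n‖ * ‖Ψ n‖) ∧ ∀ ξ, HasSum (fun n => ρ n ξ • Ψ n) (T ξ)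

/-- `T` is a nuclear map. -/
def IsNuclearMap (T : E →ₗ[ℂ] F) : Prop :=
  ∃ (ρ : ℕ → StrongDual ℂ E) (Ψ : ℕ → F), IsNuclearDecomposition T ρ Ψ

/-- The nuclear norm of a nuclear map, the infimum of `∑ₙ ‖ρₙ‖ ‖Ψₙ‖` over all decompositions. -/
def nuclearNorm (T : E →ₗ[ℂ] F) : ℝ :=
  sInf {r | ∃ (ρ : ℕ → StrongDual ℂ E) (Ψ : ℕ → F),
    IsNuclearDecomposition T ρ Ψ ∧ r = ∑' n, ‖ρ n‖ * ‖Ψ n‖}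

end Nuclear

end

/-! ### Fock space operators on the dense exterior algebra: anticommutation relations and parity. -/

noncomputable section
namespace FermiFock

variable {H : Type*} [NormedAddCommGroup H] [InnerProductSpace ℂ H]

/-! Write `[C, A}` for the graded commutator of an odd operator `C` with `A`. Since annihilation
operators kill `Ω`, the product of `ψ₁ ∧ … ∧ ψₙ` with `X A Ω` equals, by symmetry of `X`, the vacuum
expectation of `A` after iterated graded commutators with `a(Xψ₁), …, a(Xψₙ)`.

Split `a(χ) = b₊(χ) + b₋(χ)` with `b±(χ) = (a(χ) ± a*(Γχ)) / 2`. For `ψ ∈ K` the anticommutator of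
`b₊(χ)` with `φ[ψ]` is `⟨χ, ψ + Γψ⟩ / 2`, and `ψ + Γψ` lies in `Lφ`; so for `χ ⊥ Lφ` the graded
commutator with `b₊(χ)` vanishes on the algebra. The same holds for `b₋` and `Lπ`. Hence `a(Xψ)` may
be replaced by `D(ψ) = b₊(Tφ ψ) + b₋(Tπ ψ)`. Expanding the trace class operators into rank one
operators turns this into `D(ψ) = ∑ ⟨ψ, eᵢ⟩ cᵢ`.

Graded commutators with fields anticommute, as creation operators do. The exponential series of `R ↦
∑ a*(eᵢ) ∘ R ∘ [cᵢ, ·}`, applied to `A ↦ ⟨Ω, AΩ⟩ Ω`, therefore gives a map `F` with `a(ψ) F(A) =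
F([D(ψ), A})` (`annihilation_gradedExp`). It has the matrix elements found above, so it agrees with
`Ξ` on the algebra (`inner_gradedExp`, `inner_secondQuantization`). One step multiplies a nuclear
bound by at most `2 ∑ ‖eᵢ‖ ‖cᵢ‖`, which is at most twice the sum of the two trace norms, and the
exponential series sums these bounds (`hasNuclearBound_gradedExp`). -/

theorem denseRange_toFock : DenseRange (toFock (H := H)) :=
  UniformSpace.Completion.denseRange_coe

theorem inner_toFock (x y : ExteriorAlgebra ℂ H) :
    inner ℂ (toFock x) (toFock y) = form x y :=
  (toFock (H := H)).inner_map_map x y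

theorem inner_toFock_ext {u v : Fock H}
    (h : ∀ x : ExteriorAlgebra ℂ H, inner ℂ (toFock x) u = inner ℂ (toFock x) v) : u = v := by
  refine ext_inner_left ℂ fun w => ?_
  exact denseRange_toFock.induction_on (p := fun w => (inner ℂ w u : ℂ) = inner ℂ w v) w
    (isClosed_eq (by fun_prop) (by fun_prop)) h

theorem clm_ext_toFock {A B : Fock H →L[ℂ] Fock H} (h : ∀ x, A (toFock x) = B (toFock x)) :
    A = B :=
  ContinuousLinearMap.coeFn_injective
    (denseRange_toFock.equalizer A.continuous B.continuous (funext h))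

theorem creation_toFock (ψ : H) (x : ExteriorAlgebra ℂ H) :
    creation ψ (toFock x) = toFock (ExteriorAlgebra.ι ℂ ψ * x) :=
  ContinuousLinearMap.completion_apply_coe _ x

theorem inner_annihilation_right (ψ : H) (x y : Fock H) :
    inner ℂ x (annihilation ψ y) = inner ℂ (creation ψ x) y :=
  ContinuousLinearMap.adjoint_inner_right _ _ _

theorem annihilation_toFock (ψ : H) (x : ExteriorAlgebra ℂ H) :
    annihilation ψ (toFock x) = toFock (algAnnihilate ψ x) :=
  inner_toFock_ext fun y => by
    rw [inner_annihilation_right, creation_toFock, inner_toFock, inner_toFock, form_ι_mul_left]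

theorem annihilation_vacuum (ψ : H) : annihilation ψ (vacuum H) = 0 := by
  rw [vacuum, annihilation_toFock, ← map_one (algebraMap ℂ _), algAnnihilate_algebraMap, map_zero]

theorem norm_creation_le (ψ : H) : ‖creation ψ‖ ≤ ‖ψ‖ :=
  ContinuousLinearMap.opNorm_le_bound _ (norm_nonneg _) fun v => by
    refine denseRange_toFock.induction_on (p := fun v => ‖creation ψ v‖ ≤ ‖ψ‖ * ‖v‖) v
      (isClosed_le (by fun_prop) (by fun_prop)) fun x => ?_
    rw [creation_toFock, LinearIsometry.norm_map, LinearIsometry.norm_map]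
    exact norm_ι_mul_le ψ x

theorem norm_annihilation_le (ψ : H) : ‖annihilation ψ‖ ≤ ‖ψ‖ := by
  rw [annihilation, LinearIsometryEquiv.norm_map]
  exact norm_creation_le ψ

/-- The creation operators as a bounded linear map. -/
def creationCLM : H →L[ℂ] (Fock H →L[ℂ] Fock H) :=
  LinearMap.mkContinuous
    { toFun := creation
      map_add' := fun ψ χ => clm_ext_toFock fun x => by
        simp only [_root_.add_apply, creation_toFock, map_add, add_mul]
      map_smul' := fun c ψ => clm_ext_toFock fun x => by
        simp only [_root_.smul_apply, creation_toFock, map_smul, smul_mul_assoc,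
          RingHom.id_apply] }
    1 fun ψ => by simpa using norm_creation_le ψ

@[simp] theorem creationCLM_apply (ψ : H) : creationCLM ψ = creation ψ := rfl

/-- The annihilation operators as a bounded antilinear map. -/
def annihilationCLM : H →L⋆[ℂ] (Fock H →L[ℂ] Fock H) :=
  LinearMap.mkContinuous
    { toFun := annihilation
      map_add' := fun ψ χ => clm_ext_toFock fun x => by
        simp only [_root_.add_apply, annihilation_toFock, algAnnihilate_add, map_add,
          LinearMap.add_apply]
      map_smul' := fun c ψ => clm_ext_toFock fun x => by
        simp only [_root_.smul_apply, annihilation_toFock, algAnnihilate_smul,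
          map_smul, LinearMap.smul_apply] }
    1 fun ψ => by simpa using norm_annihilation_le ψ

@[simp] theorem annihilationCLM_apply (ψ : H) : annihilationCLM ψ = annihilation ψ := rfl

theorem creation_mul_creation_add (ψ χ : H) :
    creation ψ * creation χ + creation χ * creation ψ = 0 :=
  clm_ext_toFock fun x => by
    simp only [_root_.add_apply, mul_apply_eq_comp, creation_toFock,
      ← map_add, ← mul_assoc, ← add_mul, ExteriorAlgebra.ι_add_mul_swap]
    simp

theorem annihilation_mul_annihilation_add (ψ χ : H) :
    annihilation ψ * annihilation χ + annihilation χ * annihilation ψ = 0 := by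
  have := congrArg star (creation_mul_creation_add χ ψ)
  simpa [annihilation, ← ContinuousLinearMap.star_eq_adjoint] using this

theorem annihilation_mul_creation_add (ψ χ : H) :
    annihilation ψ * creation χ + creation χ * annihilation ψ = (inner ℂ ψ χ : ℂ) • 1 :=
  clm_ext_toFock fun x => by
    simp only [_root_.add_apply, mul_apply_eq_comp, creation_toFock,
      annihilation_toFock, algAnnihilate_ι_mul, _root_.smul_apply,
      one_apply_eq_self, ← map_add, ← map_smul]
    simp

/-- The parity of the exterior algebra, `v₁ ∧ … ∧ vₙ ↦ (-1)ⁿ v₁ ∧ … ∧ vₙ`. -/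
def algParity : ExteriorAlgebra ℂ H →ₐ[ℂ] ExteriorAlgebra ℂ H :=
  ExteriorAlgebra.map (-LinearMap.id)

theorem algParity_ι_mul (ψ : H) (x : ExteriorAlgebra ℂ H) :
    algParity (ExteriorAlgebra.ι ℂ ψ * x) = -(ExteriorAlgebra.ι ℂ ψ * algParity x) := by
  simp [algParity]

theorem algParity_algParity (x : ExteriorAlgebra ℂ H) : algParity (algParity x) = x := by
  induction x using left_induction with
  | algebraMap r => simp
  | add x y hx hy => simp [hx, hy]
  | ι_mul x v hx => rw [algParity_ι_mul, map_neg, algParity_ι_mul, hx, neg_neg]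

theorem algAnnihilate_algParity (ψ : H) (x : ExteriorAlgebra ℂ H) :
    algAnnihilate ψ (algParity x) = -algParity (algAnnihilate ψ x) := by
  induction x using left_induction with
  | algebraMap r => simp [algAnnihilate_algebraMap]
  | add x y hx hy => rw [map_add, map_add, map_add, hx, hy, map_add, neg_add]
  | ι_mul x v hx =>
    rw [algParity_ι_mul, map_neg, algAnnihilate_ι_mul, algAnnihilate_ι_mul, hx, map_sub,
      algParity_ι_mul, map_smul]
    simp

theorem form_algParity (x y : ExteriorAlgebra ℂ H) :
    form (algParity x) (algParity y) = form x y := by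
  induction y using left_induction generalizing x with
  | algebraMap r =>
    rw [AlgHom.commutes, form_algebraMap_right, form_algebraMap_right]
    congr 2
    induction x using left_induction with
    | algebraMap r => simp
    | add x y hx hy => simp [hx, hy]
    | ι_mul x v hx => simp [algParity_ι_mul, ExteriorAlgebra.algebraMapInv]
  | add y y' hy hy' => rw [map_add, form_add_right, form_add_right, hy, hy']
  | ι_mul y v hy =>
    rw [algParity_ι_mul, ← neg_one_smul ℂ, form_smul_right, form_ι_mul_right,
      algAnnihilate_algParity, ← neg_one_smul ℂ (algParity _), form_smul_left, hy,
      form_ι_mul_right]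
    simp

theorem norm_algParity (x : ExteriorAlgebra ℂ H) : ‖algParity x‖ = ‖x‖ := by
  have h : inner ℂ (algParity x) (algParity x) = inner ℂ x x := form_algParity x x
  rw [inner_self_eq_norm_sq_to_K, inner_self_eq_norm_sq_to_K] at h
  exact (sq_eq_sq₀ (norm_nonneg _) (norm_nonneg _)).1 (by exact_mod_cast h)

variable (H) in
/-- The parity operator `(-1)^N` of the Fock space. -/
def parity : Fock H →L[ℂ] Fock H :=
  ContinuousLinearMap.completion ((algParity (H := H)).toLinearMap.mkContinuous 1
    fun x => by simpa using (norm_algParity x).le)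

theorem parity_toFock (x : ExteriorAlgebra ℂ H) : parity H (toFock x) = toFock (algParity x) :=
  ContinuousLinearMap.completion_apply_coe _ x

theorem norm_parity_le : ‖parity H‖ ≤ 1 :=
  ContinuousLinearMap.opNorm_le_bound _ zero_le_one fun v => by
    refine denseRange_toFock.induction_on (p := fun v => ‖parity H v‖ ≤ 1 * ‖v‖) v
      (isClosed_le (by fun_prop) (by fun_prop)) fun x => ?_
    rw [parity_toFock, LinearIsometry.norm_map, LinearIsometry.norm_map, norm_algParity, one_mul]

theorem parity_mul_parity : parity H * parity H = 1 :=
  clm_ext_toFock fun x => by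
    simp [parity_toFock, algParity_algParity]

theorem parity_mul_creation (ψ : H) : parity H * creation ψ = -(creation ψ * parity H) :=
  clm_ext_toFock fun x => by
    simp [parity_toFock, creation_toFock, algParity_ι_mul]

theorem parity_mul_annihilation (ψ : H) :
    parity H * annihilation ψ = -(annihilation ψ * parity H) :=
  clm_ext_toFock fun x => by
    simp [parity_toFock, annihilation_toFock, algAnnihilate_algParity]

end FermiFock
end

/-! ### Graded commutators with fields, and the splitting of `a(χ)` by the involution. -/

noncomputable section
namespace FermiFock

variable {H : Type*} [NormedAddCommGroup H] [InnerProductSpace ℂ H]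

/-- The graded commutator `[C, A} = C A - α(A) C` with an odd operator `C`, where `α` is the
conjugation with the parity operator. -/
def gradedComm : (Fock H →L[ℂ] Fock H) →L[ℂ] (Fock H →L[ℂ] Fock H) →L[ℂ] (Fock H →L[ℂ] Fock H) :=
  LinearMap.mkContinuous₂
    (LinearMap.mk₂ ℂ (fun C A => C * A - parity H * A * parity H * C)
      (fun _ _ _ => by noncomm_ring)
      (fun _ _ _ => by rw [smul_mul_assoc, mul_smul_comm, smul_sub])
      (fun _ _ _ => by noncomm_ring)
      (fun _ _ _ => by
        rw [mul_smul_comm, mul_smul_comm, smul_mul_assoc, smul_mul_assoc, smul_sub]))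
    2 fun C A => by
      have h : ‖parity H * A * parity H * C‖ ≤ 1 * ‖A‖ * 1 * ‖C‖ := by
        refine (norm_mul_le _ _).trans (mul_le_mul_of_nonneg_right ?_ (norm_nonneg _))
        refine (norm_mul_le _ _).trans ?_
        refine mul_le_mul ?_ norm_parity_le (norm_nonneg _) (by positivity)
        exact (norm_mul_le _ _).trans (mul_le_mul_of_nonneg_right norm_parity_le (norm_nonneg _))
      calc _ ≤ ‖C * A‖ + ‖parity H * A * parity H * C‖ := norm_sub_le _ _
        _ ≤ ‖C‖ * ‖A‖ + 1 * ‖A‖ * 1 * ‖C‖ := add_le_add (norm_mul_le _ _) h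
        _ = 2 * ‖C‖ * ‖A‖ := by ring

theorem gradedComm_apply (C A : Fock H →L[ℂ] Fock H) :
    gradedComm C A = C * A - parity H * A * parity H * C := rfl

theorem norm_gradedComm_le (C : Fock H →L[ℂ] Fock H) : ‖gradedComm C‖ ≤ 2 * ‖C‖ :=
  ContinuousLinearMap.le_of_opNorm_le _ (LinearMap.mkContinuous₂_norm_le _ zero_le_two _) C

/-- The graded commutator with an annihilation operator, applied to the vacuum. -/
theorem gradedComm_annihilation_vacuum (ψ : H) (A : Fock H →L[ℂ] Fock H) :
    gradedComm (annihilation ψ) A (vacuum H) = annihilation ψ (A (vacuum H)) := by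
  simp [gradedComm_apply, annihilation_vacuum]

/-- `C` is a linear combination of creation and annihilation operators. -/
def IsField (C : Fock H →L[ℂ] Fock H) : Prop :=
  ∃ ψ χ : H, C = creation ψ + annihilation χ

theorem IsField.add {C D : Fock H →L[ℂ] Fock H} (hC : IsField C) (hD : IsField D) :
    IsField (C + D) := by
  obtain ⟨ψ, χ, rfl⟩ := hC
  obtain ⟨ψ', χ', rfl⟩ := hD
  refine ⟨ψ + ψ', χ + χ', ?_⟩
  simp only [← creationCLM_apply, ← annihilationCLM_apply, map_add]
  abel

theorem IsField.parity_mul {C : Fock H →L[ℂ] Fock H} (hC : IsField C) :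
    parity H * C = -(C * parity H) := by
  obtain ⟨ψ, χ, rfl⟩ := hC
  rw [mul_add, add_mul, parity_mul_creation, parity_mul_annihilation, neg_add]

theorem IsField.anticomm {C D : Fock H →L[ℂ] Fock H} (hC : IsField C) (hD : IsField D) :
    ∃ c : ℂ, C * D + D * C = c • 1 := by
  obtain ⟨ψ, χ, rfl⟩ := hC
  obtain ⟨ψ', χ', rfl⟩ := hD
  refine ⟨inner ℂ χ ψ' + inner ℂ χ' ψ, ?_⟩
  rw [add_smul, ← annihilation_mul_creation_add, ← annihilation_mul_creation_add]
  have h1 := creation_mul_creation_add ψ ψ'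
  have h2 := annihilation_mul_annihilation_add χ χ'
  calc _ = (creation ψ * creation ψ' + creation ψ' * creation ψ) +
        (annihilation χ * annihilation χ' + annihilation χ' * annihilation χ) +
        (annihilation χ * creation ψ' + creation ψ' * annihilation χ) +
        (annihilation χ' * creation ψ + creation ψ * annihilation χ') := by noncomm_ring
    _ = _ := by rw [h1, h2, zero_add, zero_add]

/-- Adding the two orders cancels the mixed terms and leaves `(CD + DC) A - A (CD + DC)`, which is
zero because the anticommutator of two fields is a scalar. -/
theorem gradedComm_gradedComm {C D : Fock H →L[ℂ] Fock H} (hC : IsField C) (hD : IsField D)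
    (A : Fock H →L[ℂ] Fock H) :
    gradedComm C (gradedComm D A) = -gradedComm D (gradedComm C A) := by
  obtain ⟨c, hc⟩ := hC.anticomm hD
  have hZ := parity_mul_parity (H := H)
  have key : ∀ {C D : Fock H →L[ℂ] Fock H}, IsField C → IsField D →
      gradedComm C (gradedComm D A) = C * D * A - C * (parity H * A * parity H) * D +
        D * (parity H * A * parity H) * C - A * (D * C) := by
    intro C D hC hD
    have e1 : parity H * (D * A) * parity H = -(D * (parity H * A * parity H)) := by
      rw [← mul_assoc, hD.parity_mul]; noncomm_ring
    have e2 : parity H * (parity H * A * parity H * D) * parity H * C = -(A * (D * C)) := by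
      calc _ = (parity H * parity H) * A * (parity H * D) * parity H * C := by noncomm_ring
        _ = -((parity H * parity H) * A * D * (parity H * parity H) * C) := by
          rw [hD.parity_mul]; noncomm_ring
        _ = _ := by rw [hZ]; noncomm_ring
    rw [gradedComm_apply, gradedComm_apply, mul_sub C, mul_sub (parity H), sub_mul, sub_mul, e1, e2]
    noncomm_ring
  have hc' : D * C = c • 1 - C * D := by rw [← hc]; abel
  rw [key hC hD, key hD hC, hc']
  simp only [sub_mul, mul_sub, smul_mul_assoc, mul_smul_comm, one_mul, mul_one]
  abel

/-- A field anticommuting with all `φ[ψ]`, `ψ ∈ K`, has vanishing graded commutators with the von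
Neumann algebra of these. -/
theorem gradedComm_eq_zero_of_mem_fieldAlgebra [CompleteSpace H] {K : Set H}
    {C A : Fock H →L[ℂ] Fock H} (hC : ∀ ψ ∈ K, C * fermiField ψ + fermiField ψ * C = 0)
    (hA : A ∈ fieldAlgebra K) : gradedComm C A = 0 := by
  -- Klein transformation: multiplying by the parity turns anticommutation with the odd fields into
  -- commutation, so `parity H * C` lies in the commutant and hence commutes with `A`.
  have hZC : parity H * C ∈ Set.centralizer (fermiField '' K) := by
    rintro _ ⟨ψ, hψ, rfl⟩
    have hf : IsField (fermiField ψ) := ⟨ψ, ψ, rfl⟩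
    have h1 : fermiField ψ * parity H = -(parity H * fermiField ψ) := by
      rw [hf.parity_mul, neg_neg]
    rw [← mul_assoc, h1, mul_assoc, neg_mul, mul_assoc, eq_neg_of_add_eq_zero_left (hC ψ hψ),
      mul_neg]
  have h : parity H * C * A = A * (parity H * C) := hA _ hZC
  rw [gradedComm_apply, mul_assoc (parity H * A), mul_assoc, ← h, mul_assoc, ← mul_assoc,
    parity_mul_parity, one_mul, sub_self]

/-- The antilinear map `χ ↦ (a(χ) + a*(Gχ)) / 2` for an antilinear map `G`. -/
def halfField (G : H →L⋆[ℂ] H) : H →L⋆[ℂ] (Fock H →L[ℂ] Fock H) :=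
  (1 / 2 : ℂ) • (annihilationCLM + creationCLM.comp G)

theorem halfField_apply (G : H →L⋆[ℂ] H) (χ : H) :
    halfField G χ = (1 / 2 : ℂ) • (annihilation χ + creation (G χ)) := rfl

theorem isField_halfField (G : H →L⋆[ℂ] H) (χ : H) : IsField (halfField G χ) := by
  refine ⟨(1 / 2 : ℂ) • G χ, (1 / 2 : ℂ) • χ, ?_⟩
  rw [halfField_apply, ← creationCLM_apply, ← annihilationCLM_apply, ← creationCLM_apply,
    ← annihilationCLM_apply, map_smul, map_smulₛₗ, smul_add, add_comm]
  congr 2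
  norm_num [Complex.conj_ofNat]

theorem halfField_add_halfField_neg (G : H →L⋆[ℂ] H) (χ : H) :
    halfField G χ + halfField (-G) χ = annihilation χ := by
  rw [halfField_apply, halfField_apply, ← creationCLM_apply, ← creationCLM_apply, neg_apply,
    map_neg, ← smul_add, add_add_add_comm, add_neg_cancel, add_zero, ← two_smul ℂ, smul_smul]
  norm_num

/-- The factor `1/2` absorbs the two summands, so splitting `a(χ)` costs no constant in the final
exponents. -/
theorem norm_halfField_le {G : H →L⋆[ℂ] H} (hG : ∀ χ, ‖G χ‖ ≤ ‖χ‖) (χ : H) :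
    ‖halfField G χ‖ ≤ ‖χ‖ := by
  rw [halfField_apply, norm_smul]
  have h1 : ‖annihilation χ + creation (G χ)‖ ≤ ‖χ‖ + ‖χ‖ :=
    (norm_add_le _ _).trans (add_le_add (norm_annihilation_le χ)
      ((norm_creation_le _).trans (hG χ)))
  have h2 : ‖(1 / 2 : ℂ)‖ = 1 / 2 := by norm_num
  rw [h2]
  linarith

theorem halfField_anticomm {G : H →L⋆[ℂ] H} {χ ψ : H}
    (h : (inner ℂ χ ψ : ℂ) + inner ℂ ψ (G χ) = 0) :
    halfField G χ * fermiField ψ + fermiField ψ * halfField G χ = 0 := by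
  have h1 := annihilation_mul_creation_add χ ψ
  have h2 := annihilation_mul_creation_add ψ (G χ)
  have h3 := annihilation_mul_annihilation_add χ ψ
  have h4 := creation_mul_creation_add (G χ) ψ
  rw [halfField_apply, fermiField, smul_mul_assoc, mul_smul_comm, ← smul_add]
  have : (annihilation χ + creation (G χ)) * (creation ψ + annihilation ψ) +
      (creation ψ + annihilation ψ) * (annihilation χ + creation (G χ)) =
      (annihilation χ * creation ψ + creation ψ * annihilation χ) +
      (annihilation ψ * creation (G χ) + creation (G χ) * annihilation ψ) +
      (annihilation χ * annihilation ψ + annihilation ψ * annihilation χ) +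
      (creation (G χ) * creation ψ + creation ψ * creation (G χ)) := by noncomm_ring
  rw [this, h1, h2, h3, h4, ← add_smul, h]
  simp

end FermiFock
end

/-! ### Calculus of nuclear bounds. -/

noncomputable section Nuclear

variable {E F : Type*} [NormedAddCommGroup E] [NormedSpace ℂ E]
  [NormedAddCommGroup F] [NormedSpace ℂ F]

/-- `T` has a nuclear decomposition `∑ₙ ρₙ(·) Ψₙ` with `∑ₙ ‖ρₙ‖ ‖Ψₙ‖ ≤ r`. -/
def HasNuclearBound (T : E →ₗ[ℂ] F) (r : ℝ) : Prop :=
  ∃ (ρ : ℕ → StrongDual ℂ E) (Ψ : ℕ → F),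
    IsNuclearDecomposition T ρ Ψ ∧ ∑' n, ‖ρ n‖ * ‖Ψ n‖ ≤ r

namespace HasNuclearBound

theorem isNuclearMap {T : E →ₗ[ℂ] F} {r : ℝ} (h : HasNuclearBound T r) : IsNuclearMap T := by
  obtain ⟨ρ, Ψ, h, -⟩ := h
  exact ⟨ρ, Ψ, h⟩

theorem nuclearNorm_le {T : E →ₗ[ℂ] F} {r : ℝ} (h : HasNuclearBound T r) : nuclearNorm T ≤ r := by
  obtain ⟨ρ, Ψ, h, hr⟩ := h
  have hb : (0 : ℝ) ∈ lowerBounds {r | ∃ (ρ : ℕ → StrongDual ℂ E) (Ψ : ℕ → F),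
      IsNuclearDecomposition T ρ Ψ ∧ r = ∑' n, ‖ρ n‖ * ‖Ψ n‖} := by
    rintro _ ⟨ρ, Ψ, -, rfl⟩
    exact tsum_nonneg fun n => by positivity
  exact (csInf_le ⟨0, hb⟩ ⟨ρ, Ψ, h, rfl⟩).trans hr

theorem mono {T : E →ₗ[ℂ] F} {r s : ℝ} (h : HasNuclearBound T r) (hrs : r ≤ s) :
    HasNuclearBound T s := by
  obtain ⟨ρ, Ψ, h, hr⟩ := h
  exact ⟨ρ, Ψ, h, hr.trans hrs⟩

theorem nonneg {T : E →ₗ[ℂ] F} {r : ℝ} (h : HasNuclearBound T r) : 0 ≤ r := by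
  obtain ⟨ρ, Ψ, -, hr⟩ := h
  exact (tsum_nonneg fun n => by positivity).trans hr

/-- The index type is injected into `ℕ` and both families are extended by zero, which changes no
sum. This covers finite index types as well. -/
theorem of_countable {κ : Type*} [Countable κ] {T : E →ₗ[ℂ] F} {r : ℝ}
    (ρ : κ → StrongDual ℂ E) (Ψ : κ → F) (h1 : Summable fun i => ‖ρ i‖ * ‖Ψ i‖)
    (h2 : ∀ ξ, HasSum (fun i => ρ i ξ • Ψ i) (T ξ)) (h3 : ∑' i, ‖ρ i‖ * ‖Ψ i‖ ≤ r) :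
    HasNuclearBound T r := by
  obtain ⟨f, hf⟩ := exists_injective_nat κ
  have e1 : (fun n => ‖Function.extend f ρ 0 n‖ * ‖Function.extend f Ψ 0 n‖) =
      Function.extend f (fun i => ‖ρ i‖ * ‖Ψ i‖) 0 := by
    funext n
    by_cases hn : ∃ i, f i = n
    · obtain ⟨i, rfl⟩ := hn
      simp only [hf.extend_apply]
    · simp [Function.extend_apply' _ _ _ hn]
  have e2 : ∀ ξ, (fun n => Function.extend f ρ 0 n ξ • Function.extend f Ψ 0 n) =
      Function.extend f (fun i => ρ i ξ • Ψ i) 0 := fun ξ => by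
    funext n
    by_cases hn : ∃ i, f i = n
    · obtain ⟨i, rfl⟩ := hn
      simp only [hf.extend_apply]
    · simp [Function.extend_apply' _ _ _ hn]
  refine ⟨Function.extend f ρ 0, Function.extend f Ψ 0, ⟨?_, fun ξ => ?_⟩, ?_⟩
  · rw [e1]
    exact ((hasSum_extend_zero hf).2 h1.hasSum).summable
  · rw [e2]
    exact (hasSum_extend_zero hf).2 (h2 ξ)
  · rw [e1, ((hasSum_extend_zero hf).2 h1.hasSum).tsum_eq]
    exact h3

theorem smulRight (ρ : StrongDual ℂ E) (Ψ : F) :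
    HasNuclearBound (ρ.smulRight Ψ : E →ₗ[ℂ] F) (‖ρ‖ * ‖Ψ‖) :=
  of_countable (κ := Unit) (fun _ => ρ) (fun _ => Ψ) (hasSum_fintype _).summable
    (fun ξ => by simp) (by simp)

theorem comp {E' F' : Type*} [NormedAddCommGroup E'] [NormedSpace ℂ E']
    [NormedAddCommGroup F'] [NormedSpace ℂ F'] {T : E →ₗ[ℂ] F} {r : ℝ} (h : HasNuclearBound T r)
    (U : F →L[ℂ] F') (V : E' →L[ℂ] E) :
    HasNuclearBound (U.toLinearMap ∘ₗ T ∘ₗ V.toLinearMap) (‖U‖ * ‖V‖ * r) := by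
  obtain ⟨ρ, Ψ, ⟨h1, h2⟩, hr⟩ := h
  have hle : ∀ n, ‖(ρ n).comp V‖ * ‖U (Ψ n)‖ ≤ ‖U‖ * ‖V‖ * (‖ρ n‖ * ‖Ψ n‖) := fun n =>
    (mul_le_mul ((ρ n).opNorm_comp_le V) (U.le_opNorm _) (norm_nonneg _)
      (by positivity)).trans_eq (by ring)
  have hs := Summable.of_nonneg_of_le (fun n => by positivity) hle (h1.mul_left _)
  refine ⟨fun n => (ρ n).comp V, fun n => U (Ψ n), ⟨hs, fun ξ => ?_⟩, ?_⟩
  · simpa using (h2 (V ξ)).mapL U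
  · refine (hs.tsum_le_tsum hle (h1.mul_left _)).trans ?_
    rw [tsum_mul_left]
    exact mul_le_mul_of_nonneg_left hr (by positivity)

theorem norm_apply_le {T : E →ₗ[ℂ] F} {r : ℝ} (h : HasNuclearBound T r) (ξ : E) :
    ‖T ξ‖ ≤ r * ‖ξ‖ := by
  obtain ⟨ρ, Ψ, ⟨h1, h2⟩, hr⟩ := h
  rw [← (h2 ξ).tsum_eq]
  refine (tsum_of_norm_bounded (h1.mul_right ‖ξ‖).hasSum fun n => ?_).trans ?_
  · rw [norm_smul]
    exact (mul_le_mul_of_nonneg_right ((ρ n).le_opNorm ξ) (norm_nonneg _)).trans_eq (by ring)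
  · rw [tsum_mul_right]
    exact mul_le_mul_of_nonneg_right hr (norm_nonneg _)

/-- Decompositions of the summands are merged into one double family; its absolute convergence
permits summation fibre by fibre. -/
theorem hasSum [CompleteSpace F] {ι : Type*} [Countable ι] {T : ι → E →ₗ[ℂ] F} {r : ι → ℝ}
    {S : E →ₗ[ℂ] F} {s : ℝ} (hT : ∀ i, HasNuclearBound (T i) (r i)) (hr : HasSum r s)
    (hS : ∀ ξ, HasSum (fun i => T i ξ) (S ξ)) : HasNuclearBound S s := by
  choose ρ Ψ h hr' using hT
  have hfib : ∀ i, Summable fun n => ‖ρ i n‖ * ‖Ψ i n‖ := fun i => (h i).1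
  have hs : Summable fun i => ∑' n, ‖ρ i n‖ * ‖Ψ i n‖ :=
    Summable.of_nonneg_of_le (fun i => tsum_nonneg fun n => by positivity) hr' hr.summable
  have hsum : Summable fun p : ι × ℕ => ‖ρ p.1 p.2‖ * ‖Ψ p.1 p.2‖ :=
    (summable_prod_of_nonneg fun p => by positivity).2 ⟨hfib, hs⟩
  refine of_countable (fun p : ι × ℕ => ρ p.1 p.2) (fun p => Ψ p.1 p.2) hsum (fun ξ => ?_) ?_
  · have hξ : Summable fun p : ι × ℕ => ρ p.1 p.2 ξ • Ψ p.1 p.2 := by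
      refine Summable.of_norm_bounded (hsum.mul_right ‖ξ‖) fun p => ?_
      rw [norm_smul]
      exact (mul_le_mul_of_nonneg_right ((ρ p.1 p.2).le_opNorm ξ) (norm_nonneg _)).trans_eq
        (by ring)
    have := hξ.hasSum.prod_fiberwise fun i => (h i).2 ξ
    rw [(hS ξ).unique this]
    exact hξ.hasSum
  · rw [hsum.tsum_prod' hfib]
    exact (hs.tsum_le_tsum hr' hr.summable).trans_eq hr.tsum_eq

end HasNuclearBound

end Nuclear

/-! ### Rank one expansion of trace class operators. -/

noncomputable section
namespace FermiFock
universe u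
variable {H : Type u} [NormedAddCommGroup H] [InnerProductSpace ℂ H] [CompleteSpace H]

/-- Distinct members are at distance `√2`, so the balls of radius `1/2` around them are disjoint
open sets in a separable space. -/
theorem countable_of_orthonormal {E : Type*} [NormedAddCommGroup E] [InnerProductSpace ℂ E]
    [TopologicalSpace.SeparableSpace E] {ι : Type*} {v : ι → E} (hv : Orthonormal ℂ v) :
    Countable ι := by
  refine Pairwise.countable_of_isOpen_disjoint (s := fun i => Metric.ball (v i) (1 / 2))
    (fun i j hij => Metric.ball_disjoint_ball ?_) (fun i => Metric.isOpen_ball)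
    fun i => Metric.nonempty_ball.2 one_half_pos
  have h1 := norm_sub_sq (𝕜 := ℂ) (v i) (v j)
  rw [hv.1, hv.1, hv.2 hij, map_zero] at h1
  rw [dist_eq_norm]
  nlinarith [norm_nonneg (v i - v j)]

theorem norm_cfcAbs_apply (T : H →L[ℂ] H) (x : H) : ‖CFC.abs T x‖ = ‖T x‖ := by
  have hsa : IsSelfAdjoint (CFC.abs T) := (CFC.abs_nonneg T).isSelfAdjoint
  have h : (inner ℂ (CFC.abs T x) (CFC.abs T x) : ℂ) = inner ℂ (T x) (T x) := by
    rw [← ContinuousLinearMap.adjoint_inner_right, ← ContinuousLinearMap.adjoint_inner_right,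
      ← ContinuousLinearMap.star_eq_adjoint, ← ContinuousLinearMap.star_eq_adjoint, hsa.star_eq,
      ← mul_apply_eq_comp, ← mul_apply_eq_comp, CFC.abs_mul_abs]
  rw [inner_self_eq_norm_sq_to_K, inner_self_eq_norm_sq_to_K] at h
  exact (sq_eq_sq₀ (norm_nonneg _) (norm_nonneg _)).1 (by exact_mod_cast h)

/-- The contraction of the polar decomposition `T = U |T|`. -/
theorem exists_polar_contraction (T : H →L[ℂ] H) :
    ∃ U : H →L[ℂ] H, (∀ x, U (CFC.abs T x) = T x) ∧ ∀ x, ‖U x‖ ≤ ‖x‖ := by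
  let K := (LinearMap.range (CFC.abs T).toLinearMap).topologicalClosure
  let e : H →ₗ[ℂ] K := (CFC.abs T).toLinearMap.codRestrict K fun x =>
    Submodule.le_topologicalClosure _ (LinearMap.mem_range_self _ x)
  have he : DenseRange e := by
    intro y
    rw [closure_subtype]
    have hy : (y : H) ∈ closure (Set.range fun x => CFC.abs T x) := y.2
    convert hy
    ext z
    constructor
    · rintro ⟨_, ⟨x, rfl⟩, rfl⟩
      exact ⟨x, rfl⟩
    · rintro ⟨x, rfl⟩
      exact ⟨e x, ⟨x, rfl⟩, rfl⟩
  have hn : ∀ x, ‖T.toLinearMap x‖ ≤ 1 * ‖e x‖ := fun x => by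
    rw [one_mul]
    exact (norm_cfcAbs_apply T x).ge
  have : CompleteSpace K := (Submodule.isClosed_topologicalClosure _).completeSpace_coe
  refine ⟨(T.toLinearMap.extendOfNorm e).comp K.orthogonalProjectionOnto, fun x => ?_, fun x => ?_⟩
  · have : K.orthogonalProjectionOnto (CFC.abs T x) = e x :=
      Submodule.orthogonalProjectionOnto_mem_subspace_eq_self (e x)
    rw [ContinuousLinearMap.comp_apply, this, LinearMap.extendOfNorm_eq he ⟨1, hn⟩]
    rfl
  · refine (LinearMap.norm_extendOfNorm_apply_le he 1 hn _).trans ?_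
    rw [one_mul]
    exact K.norm_orthogonalProjectionOnto_apply_le x

/-- A trace class operator is a sum of operators of rank one, whose norms add up to the trace
norm. -/
theorem IsTraceClass.exists_hasSum [TopologicalSpace.SeparableSpace H] {T : H →L[ℂ] H}
    (hT : IsTraceClass T) :
    ∃ (ι : Type u) (_ : Countable ι) (e f : ι → H) (s : ℝ), s ≤ (traceNorm T).toReal ∧
      (∀ ψ, HasSum (fun i => (inner ℂ (e i) ψ : ℂ) • f i) (T ψ)) ∧
      HasSum (fun i => ‖e i‖ * ‖f i‖) s := by
  obtain ⟨U, hU, hU'⟩ := exists_polar_contraction T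
  obtain ⟨w, b, -⟩ := exists_hilbertBasis ℂ H
  have hw : Countable w := countable_of_orthonormal b.orthonormal
  set S := CFC.sqrt (CFC.abs T) with hS
  have hSS : ∀ x, S (S x) = CFC.abs T x := fun x => by
    rw [← mul_apply_eq_comp, hS, CFC.sqrt_mul_sqrt_self (CFC.abs T) (CFC.abs_nonneg T)]
  have hsa : ∀ x y, inner ℂ (S x) y = inner ℂ x (S y) := fun x y =>
    ((CFC.sqrt_nonneg (CFC.abs T)).isSelfAdjoint.isSymmetric x y)
  have htr : traceNorm T = ∑' i, ENNReal.ofReal (‖S (b i)‖ ^ 2) := by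
    rw [traceNorm_eq_tsum b]
    refine tsum_congr fun i => ?_
    rw [← hSS, ← hsa]
    congr 1
    exact inner_self_eq_norm_sq (𝕜 := ℂ) _
  have hfin : ∑' i, ENNReal.ofReal (‖S (b i)‖ ^ 2) ≠ ⊤ := htr ▸ hT.ne
  have hsum : Summable fun i => ‖S (b i)‖ ^ 2 := by
    have := ENNReal.summable_toReal hfin
    simpa [ENNReal.toReal_ofReal, sq_nonneg] using this
  have hle : ∀ i, ‖S (b i)‖ * ‖U (S (b i))‖ ≤ ‖S (b i)‖ ^ 2 := fun i => by
    rw [sq]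
    exact mul_le_mul_of_nonneg_left (hU' _) (norm_nonneg _)
  have hsum' := Summable.of_nonneg_of_le (fun i => by positivity) hle hsum
  -- With `T = U S S` and `S` the self-adjoint root of `|T|`, expanding `S ψ` in the basis has
  -- coefficients `⟨S bᵢ, ψ⟩`. Since `U` is a contraction, each product of norms is at most `‖S
  -- bᵢ‖²`, and these add up to the trace of `|T|`.
  refine ⟨w, hw, fun i => S (b i), fun i => U (S (b i)), _, ?_, fun ψ => ?_, hsum'.hasSum⟩
  · refine (hsum'.tsum_le_tsum hle hsum).trans_eq ?_
    rw [htr, ← ENNReal.ofReal_tsum_of_nonneg (fun i => sq_nonneg _) hsum,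
      ENNReal.toReal_ofReal (tsum_nonneg fun i => sq_nonneg _)]
  · have := ((b.hasSum_repr (S ψ)).mapL S).mapL U
    rw [hSS, hU] at this
    simpa [HilbertBasis.repr_apply_apply, hsa] using this

end FermiFock
end

/-! ### The exponential series that represents `Ξ`. -/

noncomputable section
namespace FermiFock
variable {H : Type*} [NormedAddCommGroup H] [InnerProductSpace ℂ H]

section ExpSeries

variable {ι : Type*} (e : ι → H) (c : ι → (Fock H →L[ℂ] Fock H))

/-- `R ↦ ∑ᵢ a*(eᵢ) ∘ R ∘ [cᵢ, · }`. -/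
def gradedStep (R : (Fock H →L[ℂ] Fock H) →L[ℂ] Fock H) : (Fock H →L[ℂ] Fock H) →L[ℂ] Fock H :=
  ∑' i, (creation (e i)).comp (R.comp (gradedComm (c i)))

variable {e c}

theorem norm_gradedStep_term_le (R : (Fock H →L[ℂ] Fock H) →L[ℂ] Fock H) (i : ι) :
    ‖(creation (e i)).comp (R.comp (gradedComm (c i)))‖ ≤ 2 * (‖e i‖ * ‖c i‖) * ‖R‖ :=
  calc _ ≤ ‖creation (e i)‖ * (‖R‖ * ‖gradedComm (c i)‖) :=
        (ContinuousLinearMap.opNorm_comp_le _ _).trans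
          (mul_le_mul_of_nonneg_left (ContinuousLinearMap.opNorm_comp_le _ _) (norm_nonneg _))
    _ ≤ ‖e i‖ * (‖R‖ * (2 * ‖c i‖)) := by
        gcongr
        · exact norm_creation_le _
        · exact norm_gradedComm_le _
    _ = _ := by ring

theorem hasSum_gradedStep (hs : Summable fun i => ‖e i‖ * ‖c i‖)
    (R : (Fock H →L[ℂ] Fock H) →L[ℂ] Fock H) (A : Fock H →L[ℂ] Fock H) :
    HasSum (fun i => creation (e i) (R (gradedComm (c i) A))) (gradedStep e c R A) := by
  have h := (Summable.of_norm_bounded ((hs.mul_left 2).mul_right ‖R‖)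
    (norm_gradedStep_term_le (e := e) (c := c) R)).hasSum
  exact h.mapL (ContinuousLinearMap.apply ℂ (Fock H) A)

/-- Each summand is `R` composed on both sides with bounded maps. The factor `2` comes from the two
terms of the graded commutator and is the `2` in the final exponents. -/
theorem hasNuclearBound_gradedStep [Countable ι] {s : ℝ}
    (hs : HasSum (fun i => ‖e i‖ * ‖c i‖) s) {R : (Fock H →L[ℂ] Fock H) →L[ℂ] Fock H} {r : ℝ}
    (hR : HasNuclearBound (R : (Fock H →L[ℂ] Fock H) →ₗ[ℂ] Fock H) r) :
    HasNuclearBound (gradedStep e c R : (Fock H →L[ℂ] Fock H) →ₗ[ℂ] Fock H) (2 * s * r) := by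
  refine HasNuclearBound.hasSum (fun i => (hR.comp (creation (e i)) (gradedComm (c i))).mono
    (s := 2 * (‖e i‖ * ‖c i‖) * r) ?_) ((hs.mul_left 2).mul_right r)
    fun A => hasSum_gradedStep hs.summable R A
  refine mul_le_mul_of_nonneg_right ?_ hR.nonneg
  calc _ ≤ ‖e i‖ * (2 * ‖c i‖) :=
        mul_le_mul (norm_creation_le _) (norm_gradedComm_le _) (norm_nonneg _) (norm_nonneg _)
    _ = _ := by ring

variable (e c) in
/-- The terms of the exponential series of `gradedStep`, applied to `A ↦ ⟨Ω, A Ω⟩ Ω`. -/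
def gradedTerm : ℕ → (Fock H →L[ℂ] Fock H) →L[ℂ] Fock H
  | 0 => ((innerSL ℂ (vacuum H)).comp
      (ContinuousLinearMap.apply ℂ (Fock H) (vacuum H))).smulRight (vacuum H)
  | n + 1 => ((n + 1 : ℂ)⁻¹) • gradedStep e c (gradedTerm n)

theorem gradedTerm_zero_apply (A : Fock H →L[ℂ] Fock H) :
    gradedTerm e c 0 A = (inner ℂ (vacuum H) (A (vacuum H)) : ℂ) • vacuum H := rfl

theorem smul_gradedTerm_succ (n : ℕ) (A : Fock H →L[ℂ] Fock H) :
    ((n + 1 : ℂ)) • gradedTerm e c (n + 1) A = gradedStep e c (gradedTerm e c n) A := by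
  change ((n + 1 : ℂ)) • ((n + 1 : ℂ)⁻¹ • gradedStep e c (gradedTerm e c n) A) = _
  rw [smul_smul, mul_inv_cancel₀ (Nat.cast_add_one_ne_zero n), one_smul]

theorem norm_vacuum : ‖vacuum H‖ = 1 := by
  have h : (inner ℂ (vacuum H) (vacuum H) : ℂ) = 1 := by
    rw [vacuum, inner_toFock, ← map_one (algebraMap ℂ _), form_algebraMap_right]
    simp
  have h' : ‖vacuum H‖ ^ 2 = 1 := by
    rw [← inner_self_eq_norm_sq (𝕜 := ℂ), h]
    simp
  exact (pow_eq_one_iff_of_nonneg (norm_nonneg _) two_ne_zero).1 h'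

theorem hasNuclearBound_gradedTerm [Countable ι] {s : ℝ}
    (hs : HasSum (fun i => ‖e i‖ * ‖c i‖) s) (n : ℕ) :
    HasNuclearBound (gradedTerm e c n : (Fock H →L[ℂ] Fock H) →ₗ[ℂ] Fock H)
      ((2 * s) ^ n / n.factorial) := by
  induction n with
  | zero =>
    refine (HasNuclearBound.smulRight _ _).mono ?_
    rw [norm_vacuum, mul_one]
    refine (ContinuousLinearMap.opNorm_le_bound _ zero_le_one fun A => ?_).trans (by simp)
    change ‖(inner ℂ (vacuum H) (A (vacuum H)) : ℂ)‖ ≤ _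
    refine (norm_inner_le_norm _ _).trans ?_
    rw [norm_vacuum]
    simpa [norm_vacuum] using A.le_opNorm (vacuum H)
  | succ n ih =>
    -- Division by `n + 1` is treated as composition with a multiple of the identity.
    have h := (hasNuclearBound_gradedStep hs ih).comp
      ((n + 1 : ℂ)⁻¹ • ContinuousLinearMap.id ℂ (Fock H)) (ContinuousLinearMap.id ℂ _)
    refine h.mono ?_
    have hs0 : 0 ≤ s := hs.nonneg fun i => by positivity
    have h1 : ‖(n + 1 : ℂ)⁻¹ • ContinuousLinearMap.id ℂ (Fock H)‖ ≤ ((n + 1 : ℝ))⁻¹ := by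
      rw [norm_smul, norm_inv]
      have : ‖(n + 1 : ℂ)‖ = n + 1 := by exact_mod_cast Complex.norm_natCast (n + 1)
      rw [this]
      exact mul_le_of_le_one_right (by positivity) ContinuousLinearMap.norm_id_le
    calc _ ≤ (n + 1 : ℝ)⁻¹ * 1 * (2 * s * ((2 * s) ^ n / n.factorial)) := by
          gcongr
          exact ContinuousLinearMap.norm_id_le
      _ = _ := by
          rw [Nat.factorial_succ]
          push_cast
          field_simp
          ring

variable (e c) in
/-- The exponential series of `gradedStep`, applied to `A ↦ ⟨Ω, A Ω⟩ Ω`. -/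
def gradedExp : (Fock H →L[ℂ] Fock H) →L[ℂ] Fock H := ∑' n, gradedTerm e c n

/-- A nuclear bound dominates the operator norm, so the terms are majorized by an exponential series
and converge in norm. -/
theorem hasSum_gradedExp [Countable ι] (hs : Summable fun i => ‖e i‖ * ‖c i‖)
    (A : Fock H →L[ℂ] Fock H) :
    HasSum (fun n => gradedTerm e c n A) (gradedExp e c A) := by
  have h := (Summable.of_norm_bounded (Real.summable_pow_div_factorial (2 * ∑' i, ‖e i‖ * ‖c i‖))
    fun n => ContinuousLinearMap.opNorm_le_bound (gradedTerm e c n)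
      (hasNuclearBound_gradedTerm hs.hasSum n).nonneg
      (hasNuclearBound_gradedTerm hs.hasSum n).norm_apply_le).hasSum
  exact h.mapL (ContinuousLinearMap.apply ℂ (Fock H) A)

theorem hasNuclearBound_gradedExp [Countable ι] {s : ℝ}
    (hs : HasSum (fun i => ‖e i‖ * ‖c i‖) s) :
    HasNuclearBound (gradedExp e c : (Fock H →L[ℂ] Fock H) →ₗ[ℂ] Fock H) (Real.exp (2 * s)) := by
  refine HasNuclearBound.hasSum (hasNuclearBound_gradedTerm hs) ?_ (hasSum_gradedExp hs.summable)
  rw [Real.exp_eq_exp_ℝ]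
  exact NormedSpace.expSeries_div_hasSum_exp (2 * s)

/-- With `D = ∑ᵢ ⟨ψ, eᵢ⟩ cᵢ`, the annihilation operator `a(ψ)` acts on the values of the terms of the
series by composition with `[D, · }`. -/
theorem annihilation_gradedTerm_succ (hs : Summable fun i => ‖e i‖ * ‖c i‖)
    (hc : ∀ i, IsField (c i)) {ψ : H} {D : Fock H →L[ℂ] Fock H} (hD : IsField D)
    (hsum : HasSum (fun i => (inner ℂ ψ (e i) : ℂ) • c i) D) (n : ℕ)
    (A : Fock H →L[ℂ] Fock H) :
    annihilation ψ (gradedTerm e c (n + 1) A) = gradedTerm e c n (gradedComm D A) := by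
  -- Moving `a(ψ)` past `a*(eᵢ)` yields the scalars `⟨ψ, eᵢ⟩`, which assemble to `D`, and a
  -- remainder `v` with the opposite sign.
  have step : ∀ (R : (Fock H →L[ℂ] Fock H) →L[ℂ] Fock H) (A : Fock H →L[ℂ] Fock H) (v : Fock H),
      HasSum (fun i => creation (e i) (annihilation ψ (R (gradedComm (c i) A)))) v →
      annihilation ψ (gradedStep e c R A) = R (gradedComm D A) - v := by
    intro R A v hv
    have h1 := (hasSum_gradedStep hs R A).mapL (annihilation ψ)
    have h2 : HasSum (fun i => (inner ℂ ψ (e i) : ℂ) • R (gradedComm (c i) A))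
        (R (gradedComm D A)) := by
      simpa using hsum.mapL (R.comp (gradedComm.flip A))
    refine h1.unique ?_
    convert h2.sub hv using 1
    funext i
    have := congrArg (fun T => T (R (gradedComm (c i) A))) (annihilation_mul_creation_add ψ (e i))
    simp only [_root_.add_apply, mul_apply_eq_comp, _root_.smul_apply, one_apply_eq_self] at this
    rw [← this]
    simp
  have hn : (n + 1 : ℂ) ≠ 0 := Nat.cast_add_one_ne_zero n
  refine smul_right_injective _ hn ?_
  change (n + 1 : ℂ) • annihilation ψ _ = (n + 1 : ℂ) • _
  rw [← map_smul, smul_gradedTerm_succ]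
  induction n generalizing A with
  | zero =>
    -- The remainder vanishes here because the zeroth term takes values in multiples of `Ω`.
    rw [step (gradedTerm e c 0) A 0]
    · simp
    · simp [gradedTerm_zero_apply, annihilation_vacuum, hasSum_zero]
  | succ n ih =>
    have ih' : ∀ A, annihilation ψ (gradedTerm e c (n + 1) A) =
        gradedTerm e c n (gradedComm D A) := fun A => by
      have hn : (n + 1 : ℂ) ≠ 0 := Nat.cast_add_one_ne_zero n
      refine smul_right_injective _ hn ?_
      change (n + 1 : ℂ) • annihilation ψ _ = (n + 1 : ℂ) • _
      rw [← map_smul, smul_gradedTerm_succ]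
      exact ih A hn
    -- By induction and anticommutation of `[D, ·}` with `[cᵢ, ·}`, the remainder is minus `n + 1`
    -- copies of the wanted vector; with the main term this makes the `n + 2` that cancels the
    -- denominator.
    rw [step (gradedTerm e c (n + 1)) A (-gradedStep e c (gradedTerm e c n) (gradedComm D A))]
    · rw [← smul_gradedTerm_succ, sub_neg_eq_add]
      push_cast
      module
    · convert (hasSum_gradedStep hs (gradedTerm e c n) (gradedComm D A)).neg using 1
      funext i
      rw [ih', gradedComm_gradedComm hD (hc i), map_neg, map_neg]

theorem annihilation_gradedExp [Countable ι] (hs : Summable fun i => ‖e i‖ * ‖c i‖)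
    (hc : ∀ i, IsField (c i)) {ψ : H} {D : Fock H →L[ℂ] Fock H} (hD : IsField D)
    (hsum : HasSum (fun i => (inner ℂ ψ (e i) : ℂ) • c i) D) (A : Fock H →L[ℂ] Fock H) :
    annihilation ψ (gradedExp e c A) = gradedExp e c (gradedComm D A) := by
  have h1 := (hasSum_gradedExp hs A).mapL (annihilation ψ)
  have h2 : HasSum (fun n => annihilation ψ (gradedTerm e c (n + 1) A))
      (gradedExp e c (gradedComm D A)) := by
    simp only [annihilation_gradedTerm_succ hs hc hD hsum]
    exact hasSum_gradedExp hs _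
  -- The zeroth term is killed by `a(ψ)`, so the series merely shifts by one, as for the derivative
  -- of an exponential.
  have h3 := HasSum.zero_add (f := fun n => annihilation ψ (gradedTerm e c n A)) h2
  rw [gradedTerm_zero_apply, map_smul, annihilation_vacuum, smul_zero, zero_add] at h3
  exact h1.unique h3

/-- All terms after the zeroth lie in the range of creation operators, which is orthogonal to `Ω`.
-/
theorem inner_vacuum_gradedExp [Countable ι] (hs : Summable fun i => ‖e i‖ * ‖c i‖)
    (A : Fock H →L[ℂ] Fock H) :
    (inner ℂ (vacuum H) (gradedExp e c A) : ℂ) = inner ℂ (vacuum H) (A (vacuum H)) := by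
  have h1 := (hasSum_gradedExp hs A).mapL (innerSL ℂ (vacuum H))
  have h2 : ∀ n, (inner ℂ (vacuum H) (gradedTerm e c (n + 1) A) : ℂ) = 0 := fun n => by
    have h := (hasSum_gradedStep hs (gradedTerm e c n) A).mapL (innerSL ℂ (vacuum H))
    have h0 : ∀ (ψ : H) (v : Fock H), (inner ℂ (vacuum H) (creation ψ v) : ℂ) = 0 := fun ψ v => by
      rw [← inner_conj_symm, ← inner_annihilation_right, annihilation_vacuum, inner_zero_right,
        map_zero]
    simp only [innerSL_apply_apply, h0] at h
    have h' := h.unique hasSum_zero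
    rw [← smul_gradedTerm_succ, inner_smul_right] at h'
    exact (mul_eq_zero.1 h').resolve_left (Nat.cast_add_one_ne_zero n)
  have h3 : (inner ℂ (vacuum H) (vacuum H) : ℂ) = 1 := by
    rw [inner_self_eq_norm_sq_to_K, norm_vacuum]
    simp
  have h4 : (inner ℂ (vacuum H) (gradedTerm e c 0 A) : ℂ) = inner ℂ (vacuum H) (A (vacuum H)) := by
    rw [gradedTerm_zero_apply, inner_smul_right, h3, mul_one]
  rw [← h4]
  refine h1.unique (hasSum_single 0 fun n hn => ?_)
  obtain ⟨m, rfl⟩ := Nat.exists_eq_succ_of_ne_zero hn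
  exact h2 m

end ExpSeries

end FermiFock
end

/-! ### Symmetry of the second quantization, and matrix elements of the series. -/

noncomputable section
namespace FermiFock
variable {H : Type*} [NormedAddCommGroup H] [InnerProductSpace ℂ H]

theorem inner_antiunitary (Γ : H ≃ₗᵢ⋆[ℂ] H) (x y : H) :
    (inner ℂ (Γ x) (Γ y) : ℂ) = inner ℂ y x := by
  have hre : ∀ x y : H, (inner ℂ (Γ x) (Γ y) : ℂ).re = (inner ℂ x y : ℂ).re := fun x y => by
    have h1 := norm_add_sq (𝕜 := ℂ) (Γ x) (Γ y)
    have h2 := norm_add_sq (𝕜 := ℂ) x y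
    rw [← map_add, Γ.norm_map, Γ.norm_map, Γ.norm_map] at h1
    simp only [RCLike.re_eq_complex_re] at h1 h2
    linarith
  rw [← inner_conj_symm y x]
  refine Complex.ext (by rw [Complex.conj_re, hre]) ?_
  have h := hre x (Complex.I • y)
  rw [map_smulₛₗ, inner_smul_right, inner_smul_right] at h
  rw [Complex.conj_im]
  simpa using h

/-- Positivity makes the quadratic form real, and complex polarization along `ψ + χ` and `ψ + iχ`
then gives symmetry. -/
theorem StrictlyPositive.inner_symm {X : H →ₗ.[ℂ] H} (hX : StrictlyPositive X) (ψ χ : X.domain) :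
    (inner ℂ (X ψ) (χ : H) : ℂ) = inner ℂ (ψ : H) (X χ) := by
  have hdiag : ∀ ψ : X.domain, (inner ℂ (X ψ) (ψ : H) : ℂ) = inner ℂ (ψ : H) (X ψ) := fun ψ => by
    by_cases h : (ψ : H) = 0
    · have : ψ = 0 := Subtype.ext h
      simp [this]
    · rw [← inner_conj_symm]
      exact Complex.conj_eq_iff_im.2 (hX ψ h).1
  have h1 := hdiag (ψ + χ)
  have h2 := hdiag (ψ + Complex.I • χ)
  simp only [LinearPMap.map_add, LinearPMap.map_smul, Submodule.coe_add, Submodule.coe_smul,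
    inner_add_left, inner_add_right, inner_smul_left, inner_smul_right, hdiag, Complex.conj_I]
    at h1 h2
  have h1' : (inner ℂ (X ψ) (χ : H) : ℂ) + inner ℂ (X χ) (ψ : H) =
      inner ℂ (ψ : H) (X χ) + inner ℂ (χ : H) (X ψ) := by linear_combination h1
  have h2' : (inner ℂ (X ψ) (χ : H) : ℂ) - inner ℂ (X χ) (ψ : H) =
      inner ℂ (ψ : H) (X χ) - inner ℂ (χ : H) (X ψ) := by
    linear_combination (-Complex.I) * h2 + ((inner ℂ (X ψ) (χ : H) : ℂ) -
      inner ℂ (X χ) (ψ : H) - inner ℂ (ψ : H) (X χ) + inner ℂ (χ : H) (X ψ)) * Complex.I_sq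
  linear_combination (h1' + h2') / 2

theorem algAnnihilate_map {V : Type*} [NormedAddCommGroup V] [InnerProductSpace ℂ V]
    (f : V →ₗ[ℂ] H) (ψ : H) (x : ExteriorAlgebra ℂ V) :
    algAnnihilate ψ (ExteriorAlgebra.map f x) =
      ExteriorAlgebra.map f (CliffordAlgebra.contractLeft (Q := (0 : QuadraticForm ℂ V))
        (innerₛₗ ℂ ψ ∘ₗ f) x) := by
  induction x using left_induction with
  | algebraMap r =>
    rw [AlgHom.commutes, algAnnihilate_algebraMap]
    erw [CliffordAlgebra.contractLeft_algebraMap]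
    rw [map_zero]
  | add x y hx hy => simp only [map_add, hx, hy]
  | ι_mul x v hx =>
    rw [map_mul, ExteriorAlgebra.map_apply_ι, algAnnihilate_ι_mul, hx]
    erw [CliffordAlgebra.contractLeft_ι_mul]
    rw [map_sub, map_smul]
    erw [map_mul, ExteriorAlgebra.map_apply_ι]
    rfl

/-- Applied with `f` the inclusion of the domain of `X` and `g` the operator `X`, this is symmetry
on wedge products. -/
theorem form_map_symm {V : Type*} [NormedAddCommGroup V] [InnerProductSpace ℂ V]
    {f g : V →ₗ[ℂ] H} (hfg : ∀ v w, (inner ℂ (f v) (g w) : ℂ) = inner ℂ (g v) (f w))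
    (x y : ExteriorAlgebra ℂ V) :
    form (ExteriorAlgebra.map f x) (ExteriorAlgebra.map g y) =
      form (ExteriorAlgebra.map g x) (ExteriorAlgebra.map f y) := by
  induction x using left_induction generalizing y with
  | algebraMap r =>
    have hinv : ∀ f : V →ₗ[ℂ] H, ExteriorAlgebra.algebraMapInv (ExteriorAlgebra.map f y) =
        ExteriorAlgebra.algebraMapInv y := fun f => by
      induction y using left_induction with
      | algebraMap r => simp
      | add x y hx hy => simp [hx, hy]
      | ι_mul x v hx => simp [ExteriorAlgebra.algebraMapInv]
    rw [AlgHom.commutes, AlgHom.commutes, ← form_conj_symm, form_algebraMap_right, hinv,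
      ← form_conj_symm (algebraMap _ _ r), form_algebraMap_right, hinv]
  | add x x' hx hx' => rw [map_add, map_add, form_add_left, form_add_left, hx, hx']
  | ι_mul x v hx =>
    have hd : innerₛₗ ℂ (f v) ∘ₗ g = innerₛₗ ℂ (g v) ∘ₗ f := LinearMap.ext fun w => hfg v w
    rw [map_mul, map_mul, ExteriorAlgebra.map_apply_ι, ExteriorAlgebra.map_apply_ι,
      form_ι_mul_left, form_ι_mul_left, algAnnihilate_map, algAnnihilate_map, hd, hx]

/-- The second quantization of a symmetric operator is symmetric. -/
theorem inner_secondQuantization {X : H →ₗ.[ℂ] H}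
    (hX : ∀ ψ χ : X.domain, (inner ℂ (X ψ) (χ : H) : ℂ) = inner ℂ (ψ : H) (X χ))
    (x : ExteriorAlgebra ℂ X.domain) (v : (secondQuantization X).domain) :
    (inner ℂ (subspaceEmbedding X.domain x) (secondQuantization X v) : ℂ) =
      inner ℂ (toFock (ExteriorAlgebra.map X.toFun x)) (v : Fock H) := by
  have h1 : ((v : Fock H), secondQuantization X v) ∈ (secondQuantization X).graph :=
    LinearPMap.mem_graph _ v
  have h2 : (secondQuantization X).graph ≤ (algSecondQuantization X).graph.topologicalClosure := by
    -- `LinearPMap.closure` returns the operator itself when it is not closable; the inclusion of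
    -- graphs holds in either case, so closability need not be proved.
    by_cases h : (algSecondQuantization X).IsClosable
    · exact h.graph_closure_eq_closure_graph.ge
    · rw [secondQuantization, LinearPMap.closure_def' h]
      exact Submodule.le_topologicalClosure _
  have h3 : IsClosed {p : Fock H × Fock H | (inner ℂ (subspaceEmbedding X.domain x) p.2 : ℂ) =
      inner ℂ (toFock (ExteriorAlgebra.map X.toFun x)) p.1} :=
    isClosed_eq (by fun_prop) (by fun_prop)
  refine closure_minimal ?_ h3 (h2 h1)
  rintro ⟨a, b⟩ hab
  obtain ⟨⟨_, y, rfl⟩, ha, hb⟩ := (LinearPMap.mem_graph_iff _).1 hab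
  dsimp only at ha hb
  subst ha hb
  have h4 : algSecondQuantization X ⟨subspaceEmbedding X.domain y, y, rfl⟩ =
      toFock (ExteriorAlgebra.map X.toFun y) := by
    change toFock (ExteriorAlgebra.map X.toFun
      ((LinearEquiv.ofInjective _ (subspaceEmbedding_injective X.domain)).symm _)) = _
    congr 2
    exact (LinearEquiv.ofInjective _ (subspaceEmbedding_injective X.domain)).symm_apply_apply y
  change (inner ℂ (subspaceEmbedding X.domain x) (algSecondQuantization X
    ⟨subspaceEmbedding X.domain y, y, rfl⟩) : ℂ) = inner ℂ _ (subspaceEmbedding X.domain y)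
  rw [h4]
  change (inner ℂ (toFock (ExteriorAlgebra.map X.domain.subtype x)) _ : ℂ) =
    inner ℂ _ (toFock (ExteriorAlgebra.map X.domain.subtype y))
  rw [inner_toFock, inner_toFock]
  exact form_map_symm (fun ψ χ => (hX ψ χ).symm) x y

theorem subspaceEmbedding_ι_mul (D : Submodule ℂ H) (ψ : D) (x : ExteriorAlgebra ℂ D) :
    subspaceEmbedding D (ExteriorAlgebra.ι ℂ ψ * x) =
      creation (ψ : H) (subspaceEmbedding D x) := by
  change toFock (ExteriorAlgebra.map D.subtype _) = creation _ (toFock (ExteriorAlgebra.map _ x))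
  rw [creation_toFock, map_mul, ExteriorAlgebra.map_apply_ι]
  rfl

theorem subspaceEmbedding_algebraMap (D : Submodule ℂ H) (r : ℂ) :
    subspaceEmbedding D (algebraMap ℂ _ r) = r • vacuum H := by
  change toFock (ExteriorAlgebra.map D.subtype (algebraMap ℂ _ r)) = _
  rw [AlgHom.commutes, Algebra.algebraMap_eq_smul_one, map_smul]
  rfl

/-- A dense subspace of the one-particle space generates a dense subspace of the Fock space. -/
theorem denseRange_subspaceEmbedding {D : Submodule ℂ H} (hD : Dense (D : Set H)) :
    DenseRange (subspaceEmbedding D) := by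
  let W := (LinearMap.range (subspaceEmbedding D)).topologicalClosure
  have hW : IsClosed (W : Set (Fock H)) := Submodule.isClosed_topologicalClosure _
  have h1 : ∀ ψ : D, ∀ w ∈ W, creation (ψ : H) w ∈ W := fun ψ w hw => by
    refine map_mem_closure (creation (ψ : H)).continuous hw ?_
    rintro _ ⟨x, rfl⟩
    exact ⟨_, subspaceEmbedding_ι_mul D ψ x⟩
  -- Invariance passes from `D` to all of `H` by continuity of `a*(ψ)` in `ψ` and density of `D`.
  have h2 : ∀ (ψ : H), ∀ w ∈ W, creation ψ w ∈ W := fun ψ w hw => by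
    have hc : Continuous fun ψ : H => creation ψ w :=
      (ContinuousLinearMap.apply ℂ (Fock H) w).continuous.comp creationCLM.continuous
    have := map_mem_closure hc (hD ψ) (t := W) fun χ hχ => h1 ⟨χ, hχ⟩ w hw
    rwa [hW.closure_eq] at this
  have h3 : ∀ x : ExteriorAlgebra ℂ H, toFock x ∈ W := fun x => by
    induction x using left_induction with
    | algebraMap r =>
      refine Submodule.le_topologicalClosure _ ⟨algebraMap ℂ _ r, ?_⟩
      rw [subspaceEmbedding_algebraMap, Algebra.algebraMap_eq_smul_one, map_smul]
      rfl
    | add x y hx hy => rw [map_add]; exact add_mem hx hy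
    | ι_mul x v hx => rw [← creation_toFock]; exact h2 v _ hx
  intro v
  exact denseRange_toFock.induction_on (p := fun v => v ∈ W) v hW h3

/-- Each factor `ψ` moves to the right as `a(ψ)` and becomes `[D(ψ), ·}`, which equals `[a(Xψ), ·}`
on `A`, and that acts on `Ω` as `a(Xψ)`. The induction runs over all `A` with vanishing graded
commutators with `S`, rather than over the von Neumann algebra, since this condition is visibly
preserved by `[D(ψ), ·}`. -/
theorem inner_gradedExp {ι : Type*} [Countable ι] {e : ι → H} {c : ι → (Fock H →L[ℂ] Fock H)}
    (hs : Summable fun i => ‖e i‖ * ‖c i‖) (hc : ∀ i, IsField (c i)) {X : H →ₗ.[ℂ] H}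
    {D : X.domain → (Fock H →L[ℂ] Fock H)} (hD : ∀ ψ, IsField (D ψ))
    (hsum : ∀ ψ : X.domain, HasSum (fun i => (inner ℂ (ψ : H) (e i) : ℂ) • c i) (D ψ))
    {S : Set (Fock H →L[ℂ] Fock H)} (hS : ∀ C ∈ S, IsField C)
    (hDS : ∀ ψ A, (∀ C ∈ S, gradedComm C A = 0) →
      gradedComm (annihilation (X ψ)) A = gradedComm (D ψ) A)
    (x : ExteriorAlgebra ℂ X.domain) {A : Fock H →L[ℂ] Fock H}
    (hA : ∀ C ∈ S, gradedComm C A = 0) :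
    (inner ℂ (subspaceEmbedding X.domain x) (gradedExp e c A) : ℂ) =
      inner ℂ (toFock (ExteriorAlgebra.map X.toFun x)) (A (vacuum H)) := by
  induction x using left_induction generalizing A with
  | algebraMap r =>
    rw [subspaceEmbedding_algebraMap, AlgHom.commutes, Algebra.algebraMap_eq_smul_one, map_smul,
      inner_smul_left, inner_smul_left, inner_vacuum_gradedExp hs]
    rfl
  | add x y hx hy =>
    rw [map_add, map_add, map_add, inner_add_left, inner_add_left, hx hA, hy hA]
  | ι_mul x ψ hx =>
    rw [subspaceEmbedding_ι_mul, ← inner_annihilation_right,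
      annihilation_gradedExp hs hc (hD ψ) (hsum ψ), hx, map_mul, ExteriorAlgebra.map_apply_ι,
      ← creation_toFock, ← inner_annihilation_right, ← gradedComm_annihilation_vacuum]
    · exact congrArg (fun T : Fock H →L[ℂ] Fock H => (inner ℂ _ (T (vacuum H)) : ℂ))
        (hDS ψ A hA).symm
    · intro C hC
      rw [gradedComm_gradedComm (hS C hC) (hD ψ), hA C hC, map_zero, neg_zero]

/-- Antiunitarity rewrites the anticommutator as a multiple of `⟨χ, ψ + Γψ⟩`. In `ψ + Γψ` the
`Γ`-odd part `v - Γv` drops out and twice `u + Γu ∈ Lφ` remains. -/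
theorem halfField_anticomm_realSubspace {Γ : H ≃ₗᵢ⋆[ℂ] H} (hΓ : ∀ ψ, Γ (Γ ψ) = ψ)
    {Lφ Lπ : Submodule ℂ H} (hLφ : ∀ ψ ∈ Lφ, Γ ψ ∈ Lφ) {χ : H} (hχ : χ ∈ Lφᗮ)
    {G : H →L⋆[ℂ] H} (hG : ∀ χ, G χ = Γ χ) {ψ : H} (hψ : ψ ∈ realSubspace Γ Lφ Lπ) :
    halfField G χ * fermiField ψ + fermiField ψ * halfField G χ = 0 := by
  refine halfField_anticomm ?_
  obtain ⟨u, hu, v, hv, rfl⟩ := hψ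
  have h1 : (u + Γ u + (v - Γ v)) + Γ (u + Γ u + (v - Γ v)) = (u + Γ u) + (u + Γ u) := by
    simp only [map_add, map_sub, hΓ]
    abel
  have h2 := inner_antiunitary Γ (Γ (u + Γ u + (v - Γ v))) χ
  rw [hΓ] at h2
  rw [hG, h2, ← inner_add_right, h1]
  exact Submodule.inner_left_of_mem_orthogonal (add_mem (add_mem hu (hLφ _ hu))
    (add_mem hu (hLφ _ hu))) hχ

theorem halfField_neg_anticomm_realSubspace {Γ : H ≃ₗᵢ⋆[ℂ] H} (hΓ : ∀ ψ, Γ (Γ ψ) = ψ)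
    {Lφ Lπ : Submodule ℂ H} (hLπ : ∀ ψ ∈ Lπ, Γ ψ ∈ Lπ) {χ : H} (hχ : χ ∈ Lπᗮ)
    {G : H →L⋆[ℂ] H} (hG : ∀ χ, G χ = -Γ χ) {ψ : H} (hψ : ψ ∈ realSubspace Γ Lφ Lπ) :
    halfField G χ * fermiField ψ + fermiField ψ * halfField G χ = 0 := by
  refine halfField_anticomm ?_
  obtain ⟨u, hu, v, hv, rfl⟩ := hψ
  have h1 : (u + Γ u + (v - Γ v)) - Γ (u + Γ u + (v - Γ v)) = (v - Γ v) + (v - Γ v) := by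
    simp only [map_add, map_sub, hΓ]
    abel
  have h2 := inner_antiunitary Γ (Γ (u + Γ u + (v - Γ v))) χ
  rw [hΓ] at h2
  rw [hG, inner_neg_right, h2, ← sub_eq_add_neg, ← inner_sub_right, h1]
  exact Submodule.inner_left_of_mem_orthogonal (add_mem (sub_mem hv (hLπ _ hv))
    (sub_mem hv (hLπ _ hv))) hχ

end FermiFock
end

/-! ### Assembly of the nuclear bound. -/

noncomputable section
namespace FermiFock
universe u
variable {H : Type u} [NormedAddCommGroup H] [InnerProductSpace ℂ H]

/-- Antilinearity of `halfField` conjugates the coefficients, giving exactly the `⟨ψ, eᵢ⟩` produced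
by `a(ψ) a*(eᵢ)`. -/
theorem hasSum_halfField {ι : Type*} {e f : ι → H} {T : H →L[ℂ] H}
    (h : ∀ ψ, HasSum (fun i => (inner ℂ (e i) ψ : ℂ) • f i) (T ψ)) (G : H →L⋆[ℂ] H) (ψ : H) :
    HasSum (fun i => (inner ℂ ψ (e i) : ℂ) • halfField G (f i)) (halfField G (T ψ)) := by
  simpa only [map_smulₛₗ, inner_conj_symm] using (h ψ).mapL (halfField G)

theorem exists_hasSum_norm_halfField {ι : Type*} {e f : ι → H} {G : H →L⋆[ℂ] H}
    (hG : ∀ χ, ‖G χ‖ ≤ ‖χ‖) {s : ℝ} (h : HasSum (fun i => ‖e i‖ * ‖f i‖) s) :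
    ∃ s' ≤ s, HasSum (fun i => ‖e i‖ * ‖halfField G (f i)‖) s' := by
  have hle : ∀ i, ‖e i‖ * ‖halfField G (f i)‖ ≤ ‖e i‖ * ‖f i‖ := fun i =>
    mul_le_mul_of_nonneg_left (norm_halfField_le hG _) (norm_nonneg _)
  have hs := Summable.of_nonneg_of_le (fun i => by positivity) hle h.summable
  exact ⟨_, hasSum_le hle hs.hasSum h, hs.hasSum⟩

theorem hasNuclearBound_vacuumMap [CompleteSpace H] [TopologicalSpace.SeparableSpace H]
    (Γ : H ≃ₗᵢ⋆[ℂ] H) (hΓ : ∀ ψ, Γ (Γ ψ) = ψ) (Lφ Lπ : ClosedSubmodule ℂ H)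
    (hLφ : ∀ ψ ∈ Lφ, Γ ψ ∈ Lφ) (hLπ : ∀ ψ ∈ Lπ, Γ ψ ∈ Lπ)
    (X : H →ₗ.[ℂ] H) (hdense : Dense (X.domain : Set H))
    (hX : ∀ ψ χ : X.domain, (inner ℂ (X ψ) (χ : H) : ℂ) = inner ℂ (ψ : H) (X χ))
    (hdom : ∀ A ∈ fieldAlgebra (realSubspace Γ Lφ Lπ : Set H),
      A (vacuum H) ∈ (secondQuantization X).domain)
    (Tφ Tπ : H →L[ℂ] H)
    (hTφ : ∀ ψ : X.domain, Tφ ψ = Lφ.toSubmodule.starProjection (X ψ))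
    (hTπ : ∀ ψ : X.domain, Tπ ψ = Lπ.toSubmodule.starProjection (X ψ))
    (htrφ : IsTraceClass Tφ) (htrπ : IsTraceClass Tπ) :
    HasNuclearBound (vacuumMap (fieldAlgebra (realSubspace Γ Lφ Lπ : Set H))
      (secondQuantization X) hdom)
      (Real.exp (2 * (traceNorm Tφ).toReal) * Real.exp (2 * (traceNorm Tπ).toReal)) := by
  obtain ⟨ι, _, e, f, s, hs, hef, hsum⟩ := htrφ.exists_hasSum
  obtain ⟨κ, _, g, h, t, ht, hgh, hsum'⟩ := htrπ.exists_hasSum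
  let G : H →L⋆[ℂ] H := Γ.toLinearIsometry.toContinuousLinearMap
  have hGΓ : ∀ χ, G χ = Γ χ := fun χ => rfl
  have hG : ∀ χ, ‖G χ‖ ≤ ‖χ‖ := fun χ => (Γ.norm_map χ).le
  have hG' : ∀ χ, ‖(-G) χ‖ ≤ ‖χ‖ := fun χ => by rw [neg_apply, norm_neg]; exact hG χ
  obtain ⟨s', hs', hsum1⟩ := exists_hasSum_norm_halfField hG hsum
  obtain ⟨t', ht', hsum2⟩ := exists_hasSum_norm_halfField hG' hsum'
  let E : ι ⊕ κ → H := Sum.elim e g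
  let c : ι ⊕ κ → (Fock H →L[ℂ] Fock H) :=
    Sum.elim (fun i => halfField G (f i)) fun i => halfField (-G) (h i)
  have hEc : HasSum (fun i => ‖E i‖ * ‖c i‖) (s' + t') := HasSum.sum hsum1 hsum2
  have hc : ∀ i, IsField (c i) := by
    rintro (i | i) <;> exact isField_halfField _ _
  let D : X.domain → (Fock H →L[ℂ] Fock H) := fun ψ => halfField G (Tφ ψ) + halfField (-G) (Tπ ψ)
  have hD : ∀ ψ, IsField (D ψ) := fun ψ => (isField_halfField _ _).add (isField_halfField _ _)
  have hDsum : ∀ ψ : X.domain, HasSum (fun i => (inner ℂ (ψ : H) (E i) : ℂ) • c i) (D ψ) :=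
    fun ψ => HasSum.sum (hasSum_halfField hef G ψ) (hasSum_halfField hgh (-G) ψ)
  let S : Set (Fock H →L[ℂ] Fock H) :=
    halfField G '' (Lφ.toSubmoduleᗮ : Set H) ∪ halfField (-G) '' (Lπ.toSubmoduleᗮ : Set H)
  have hS : ∀ C ∈ S, IsField C := by
    rintro _ (⟨χ, -, rfl⟩ | ⟨χ, -, rfl⟩) <;> exact isField_halfField _ _
  have hDS : ∀ ψ A, (∀ C ∈ S, gradedComm C A = 0) →
      gradedComm (annihilation (X ψ)) A = gradedComm (D ψ) A := by
    intro ψ A hA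
    -- Only the projections of `X ψ` onto `Lφ` and `Lπ` contribute, and these are `Tφ ψ` and `Tπ ψ`.
    have h1 := hA _ (Or.inl ⟨_, Lφ.toSubmodule.sub_starProjection_mem_orthogonal (X ψ), rfl⟩)
    have h2 := hA _ (Or.inr ⟨_, Lπ.toSubmodule.sub_starProjection_mem_orthogonal (X ψ), rfl⟩)
    rw [map_sub, map_sub, _root_.sub_apply, sub_eq_zero] at h1 h2
    rw [← halfField_add_halfField_neg G, map_add, map_add, _root_.add_apply, _root_.add_apply, h1,
      h2, hTφ, hTπ]
  have hAS : ∀ A ∈ fieldAlgebra (realSubspace Γ Lφ Lπ : Set H), ∀ C ∈ S, gradedComm C A = 0 := by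
    rintro A hA _ (⟨χ, hχ, rfl⟩ | ⟨χ, hχ, rfl⟩)
    · exact gradedComm_eq_zero_of_mem_fieldAlgebra
        (fun ψ hψ => halfField_anticomm_realSubspace hΓ hLφ hχ hGΓ hψ) hA
    · exact gradedComm_eq_zero_of_mem_fieldAlgebra
        (fun ψ hψ => halfField_neg_anticomm_realSubspace hΓ hLπ hχ (fun _ => rfl) hψ) hA
  let M := fieldAlgebra (realSubspace Γ Lφ Lπ : Set H)
  let V : M.toStarSubalgebra →L[ℂ] (Fock H →L[ℂ] Fock H) :=
    LinearMap.mkContinuous M.toStarSubalgebra.toSubalgebra.val.toLinearMap 1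
      fun A => (one_mul ‖A‖).ge
  have hV : ‖V‖ ≤ 1 := LinearMap.mkContinuous_norm_le _ zero_le_one _
  -- The series is defined on all bounded operators; restricting it along the inclusion `V`, of norm
  -- at most one, keeps the nuclear bound.
  have heq : vacuumMap M (secondQuantization X) hdom =
      (ContinuousLinearMap.id ℂ (Fock H)).toLinearMap ∘ₗ
        (gradedExp E c : (Fock H →L[ℂ] Fock H) →ₗ[ℂ] Fock H) ∘ₗ V.toLinearMap := by
    ext A
    change secondQuantization X ⟨(A : Fock H →L[ℂ] Fock H) (vacuum H), hdom A A.2⟩ =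
      gradedExp E c (A : Fock H →L[ℂ] Fock H)
    refine ext_inner_left ℂ fun w => ?_
    refine (denseRange_subspaceEmbedding hdense).induction_on (p := fun w =>
      (inner ℂ w (secondQuantization X ⟨(A : Fock H →L[ℂ] Fock H) (vacuum H), hdom A A.2⟩) : ℂ) =
        inner ℂ w (gradedExp E c (A : Fock H →L[ℂ] Fock H))) w
      (isClosed_eq (by fun_prop) (by fun_prop)) fun x => ?_
    rw [inner_secondQuantization hX, inner_gradedExp hEc.summable hc hD hDsum hS hDS x (hAS A A.2)]
  have hnuc := (hasNuclearBound_gradedExp hEc).comp (ContinuousLinearMap.id ℂ (Fock H)) V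
  rw [← heq] at hnuc
  refine hnuc.mono ?_
  rw [← Real.exp_add]
  calc _ ≤ 1 * 1 * Real.exp (2 * (s' + t')) := by
        gcongr
        exact ContinuousLinearMap.norm_id_le
    _ ≤ _ := by
        rw [one_mul, one_mul]
        exact Real.exp_le_exp.2 (by linarith)

end FermiFock
end

open FermiFock in
theorem mainTheorem11
    {H : Type*} [NormedAddCommGroup H] [InnerProductSpace ℂ H] [CompleteSpace H]
    [TopologicalSpace.SeparableSpace H]
    (Γ : H ≃ₗᵢ⋆[ℂ] H) (hΓ : ∀ ψ, Γ (Γ ψ) = ψ)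
    (Lφ Lπ : ClosedSubmodule ℂ H)
    (hLφ : ∀ ψ ∈ Lφ, Γ ψ ∈ Lφ) (hLπ : ∀ ψ ∈ Lπ, Γ ψ ∈ Lπ)
    (hsep : ∀ A ∈ fieldAlgebra (realSubspace Γ Lφ Lπ : Set H), A (vacuum H) = 0 → A = 0)
    (X : H →ₗ.[ℂ] H) (hdense : Dense (X.domain : Set H))
    (hpos : StrictlyPositive X) (hXΓ : CommutesWith X Γ)
    (hdom : ∀ A ∈ fieldAlgebra (realSubspace Γ Lφ Lπ : Set H),
      A (vacuum H) ∈ (secondQuantization X).domain)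
    (Tφ Tπ : H →L[ℂ] H)
    (hTφ : ∀ ψ : X.domain, Tφ ψ = Lφ.toSubmodule.starProjection (X ψ))
    (hTπ : ∀ ψ : X.domain, Tπ ψ = Lπ.toSubmodule.starProjection (X ψ))
    (htrφ : IsTraceClass Tφ) (htrπ : IsTraceClass Tπ) :
    IsNuclearMap (vacuumMap (fieldAlgebra (realSubspace Γ Lφ Lπ : Set H))
        (secondQuantization X) hdom) ∧
      nuclearNorm (vacuumMap (fieldAlgebra (realSubspace Γ Lφ Lπ : Set H))
        (secondQuantization X) hdom) ≤
        Real.exp (2 * (traceNorm Tφ).toReal) * Real.exp (2 * (traceNorm Tπ).toReal) := by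
  have h := hasNuclearBound_vacuumMap Γ hΓ Lφ Lπ hLφ hLπ X hdense hpos.inner_symm hdom Tφ Tπ hTφ hTπ
    htrφ htrπ
  exact ⟨h.isNuclearMap, h.nuclearNorm_le⟩
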